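/- **CSS codes on a lattice.** Fix $D\in\mathbb N$ and $\beta>0$, and consider rectangles $\Lambda$ of unit cells of $\mathbb Z^D$. Each unit cell carries a fixed number $q$ of qubits and at most $n_S$ stars and $n_P$ plaquettes (interactions may be truncated or removed at the boundary; boundary conditions are open or periodic in each coordinate direction). Write $|\Lambda|$ for the number of qubits in $\Lambda$ and $\mathcal H_\Lambda=\bigotimes_{v\in\Lambda}\mathbb C^2$. A star $s$ has a set of qubits $ds\subseteq\Lambda$ and a plaquette $p$ a set of qubits $\partial p\subseteq\Lambda$, each of diameter at most $1$ in the maximum distance of unit cells, such that the operators $A_s=\bigotimes_{v\in ds}X_v$ and $B_p=\bigotimes_{v\in\partial p}Z_v$ commute: $[A_s,B_p]=0$. For a qubit $v$ let $\partial v=\{s: v\in ds\}$ and $dv=\{p: v\in\partial p\}$. Let $\mathcal F=\{\Lambda_1,\Lambda_2,\dots\}$ be an increasing family of such rectangles, each equipped with a CSS code of this kind. **Davies Lindbladian.** Let $P^{\star}_{v}(\omega)$ and $P^{\square}_{v}(\omega)$ be the spectral projections of $-2\sum_{s\in\partial v}A_s$ and $-2\sum_{p\in dv}B_p$ at the eigenvalue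 $\omega$, and set $L^\star_v(\omega)=Z_vP^\star_v(\omega)$, $L^\square_v(\omega)=X_vP^\square_v(\omega)$. For $\sharp\in\{\star,\square\}$ let, in the Heisenberg picture, $$\mathcal L^\sharp_\Lambda(O)=\sum_{v\in\Lambda}\sum_\omega h^\sharp_v(\omega)\Big(L_v^\sharp(\omega)^\dagger O L_v^\sharp(\omega)-\tfrac12\{L_v^\sharp(\omega)^\dagger L_v^\sharp(\omega),O\}\Big),$$ where $\omega$ runs over these eigenvalues and the rates (which may depend on $v$ and $\Lambda$) satisfy $h^\sharp_v(\omega)>0$ and $h^\sharp_v(-\omega)=h^\sharp_v(\omega)e^{-\beta\omega}$. Put $\mathcal L^{\boxplus}_\Lambda=\mathcal L^\star_\Lambda+\mathcal L^\square_\Lambda$, and let $\mathcal L^*$ denote the adjoint with respect to the Hilbert-Schmidt inner product. **MLSI.** A family of Lindbladians $\mathcal L_\Lambda$, $\Lambda\in\mathcal F$, satisfies an MLSI with constant $\alpha>0$ if for all $\Lambda\in\mathcal F$ and all full-rank states $\sigma$ on $\mathcal H_\Lambda$, with $\mathbb E^*_\Lambda=\lim_{t\to\infty}e^{t\mathcal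 L_\Lambda^*}$, $$2\alpha\,\mathrm{Tr}\big(\sigma(\ln\sigma-\ln\mathbb E^*_\Lambda(\sigma))\big)\le-\mathrm{Tr}\big(\mathcal L^*_\Lambda(\sigma)(\ln\sigma-\ln\mathbb E^*_\Lambda(\sigma))\big).$$ **Logical operators.** A logical operator commutes with all $A_s$ and $B_p$ and does not belong to the algebra generated by them. A logical $X_L$ is a logical operator that is a product of Pauli operators $X_v$ over a set of qubits, a logical $Z_L$ is a logical operator that is a product of Pauli operators $Z_v$ over a set of qubits, and $Y_L=iX_LZ_L$. **Claim.** There is a polynomial $\mathrm{poly}$, depending only on $D,q,n_S,n_P,\beta$, such that the following holds for every such family $\mathcal F$, all such rates and every $\alpha>0$. If the star parts $\mathcal L^\star_\Lambda$, $\Lambda\in\mathcal F$, satisfy an MLSI with the constant $\alpha$ (independent of $\Lambda$), then: 1. For all $\Lambda\in\mathcal F$, all states $\sigma$ on $\mathcal H_\Lambda$, all $t>0$, and every logical operator $O_L$ of the form $X_L$ or $Y_L$, $$\big|\mathrm{Tr}\big(e^{t\mathcal L^{\boxplus,*}_\Lambda}(\sigma)\,O_L\big)\big|\le\mathrm{poly}(|\Lambda|)\,e^{-\alpha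 t}.$$ 2. Hence the information is lost in logarithmic time: for every $\varepsilon>0$ there is $c>0$, independent of $\Lambda$, such that $\big|\mathrm{Tr}\big(e^{t\mathcal L^{\boxplus,*}_\Lambda}(\sigma)\,O_L\big)\big|\le\varepsilon$ for all $\Lambda\in\mathcal F$, all states $\sigma$, all such $O_L$ and all $t\ge c\,(1+\ln|\Lambda|)$. -/

import Mathlib

namespace CSSDavies

/-! ### Operators, superoperators and quantum dynamical semigroups

Operators on a finite-dimensional Hilbert space with orthonormal basis `n` are complex matrices
indexed by `n`; superoperators are linear maps between matrices. -/

section Superoperators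

variable {n : Type*} [Fintype n] [DecidableEq n]

/-- Operators on the Hilbert space with orthonormal basis indexed by `n`. -/
abbrev Op (n : Type*) : Type _ := Matrix n n ℂ

/-- Linear maps on the space of operators. -/
abbrev SuperOp (n : Type*) : Type _ := Op n →ₗ[ℂ] Op n

section States

open scoped ComplexOrder

/-- Quantum states (density matrices). -/
def IsState (σ : Op n) : Prop := σ.PosSemidef ∧ σ.trace = 1

/-- Quantum states of full rank. -/
def IsFullRankState (σ : Op n) : Prop := σ.PosDef ∧ σ.trace = 1

end States

/-- The adjoint of a superoperator with respect to the Hilbert-Schmidt inner product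
`⟨A, B⟩ = Tr (Aᴴ B)`. The entry `(i, j)` of an operator is its inner product with the matrix unit
at `(i, j)`. The characterization is `trace_hsAdjoint`. -/
def hsAdjoint (S : SuperOp n) : SuperOp n where
  toFun A := Matrix.of fun i j => ((S (Matrix.single i j 1)).conjTranspose * A).trace
  map_add' A B := by
    ext i j
    simp [Matrix.mul_add]
  map_smul' c A := by
    ext i j
    simp

theorem trace_hsAdjoint (S : SuperOp n) (A B : Op n) :
    ((hsAdjoint S A).conjTranspose * B).trace = (A.conjTranspose * S B).trace := by
  have key : ∀ i j : n, ∀ c : ℂ,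
      ((hsAdjoint S A).conjTranspose * Matrix.single i j c).trace
        = (A.conjTranspose * S (Matrix.single i j c)).trace := by
    intro i j c
    have h1 : Matrix.single i j c = c • Matrix.single i j (1 : ℂ) := by
      simp [Matrix.smul_single]
    have h2 : (A.conjTranspose * S (Matrix.single i j 1)).trace
        = star (((S (Matrix.single i j 1)).conjTranspose * A).trace) := by
      rw [← Matrix.trace_conjTranspose, Matrix.conjTranspose_mul, Matrix.conjTranspose_conjTranspose]
    rw [h1, map_smul, Matrix.mul_smul, Matrix.mul_smul, Matrix.trace_smul, Matrix.trace_smul, h2,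
      Matrix.trace_mul_comm, Matrix.trace_single_mul]
    simp [hsAdjoint]
  rw [Matrix.matrix_eq_sum_single B]
  simp only [map_sum, Matrix.mul_sum, Matrix.trace_sum]
  exact Finset.sum_congr rfl fun i _ => Finset.sum_congr rfl fun j _ => key i j _

/-- The semigroup `e^{t S}` generated by a superoperator: the exponential of the matrix that
represents `t S` in the basis of matrix units. -/
noncomputable def semigroup (S : SuperOp n) (t : ℝ) : SuperOp n :=
  (LinearMap.toMatrixAlgEquiv (Matrix.stdBasis ℂ n n)).symm
    (NormedSpace.exp ((t : ℂ) • LinearMap.toMatrixAlgEquiv (Matrix.stdBasis ℂ n n) S))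

/-- The Schrödinger evolution `e^{t L*}` of the Heisenberg-picture Lindbladian `L`. -/
noncomputable def evolve (L : SuperOp n) (t : ℝ) : SuperOp n := semigroup (hsAdjoint L) t

/-- The long-time limit `E*(σ) = lim_{t → ∞} e^{t L*}(σ)` in the Schrödinger picture. -/
noncomputable def longTimeLimit (L : SuperOp n) (σ : Op n) : Op n :=
  Filter.limUnder Filter.atTop fun t : ℝ => evolve L t σ

/-- The logarithm of a positive definite operator, through the functional calculus. -/
noncomputable def opLog (A : Op n) : Op n := cfc Real.log A

/-- The relative entropy `D(σ ‖ τ) = Tr (σ (ln σ - ln τ))` of full-rank states. -/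
noncomputable def relEntropy (σ τ : Op n) : ℝ := (σ * (opLog σ - opLog τ)).trace.re

/-- The entropy production `EP(σ) = - Tr (L*(σ) (ln σ - ln E*(σ)))` of a full-rank state. -/
noncomputable def entropyProduction (L : SuperOp n) (σ : Op n) : ℝ :=
  -(hsAdjoint L σ * (opLog σ - opLog (longTimeLimit L σ))).trace.re

/-- The modified logarithmic Sobolev inequality with constant `α` for a family of Lindbladians
(in the Heisenberg picture). -/
def SatisfiesMLSI {ι : Type*} {m : ι → Type*} [∀ i, Fintype (m i)] [∀ i, DecidableEq (m i)]
    (L : ∀ i, SuperOp (m i)) (α : ℝ) : Prop :=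
  ∀ (i : ι) (σ : Op (m i)), IsFullRankState σ →
    2 * α * relEntropy σ (longTimeLimit (L i) σ) ≤ entropyProduction (L i) σ

/-- The Lindblad term of a single jump operator `J` in the Heisenberg picture,
`O ↦ Jᴴ O J - (1/2) {Jᴴ J, O}`. -/
noncomputable def dissipator (J : Op n) : SuperOp n where
  toFun O := J.conjTranspose * O * J
    - (1 / 2 : ℂ) • (J.conjTranspose * J * O + O * (J.conjTranspose * J))
  map_add' A B := by
    simp only [Matrix.mul_add, Matrix.add_mul, smul_add]
    abel
  map_smul' c A := by
    simp only [Matrix.mul_smul, Matrix.smul_mul, smul_add, smul_sub, RingHom.id_apply,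
      smul_comm c (1 / 2 : ℂ)]

/-- The (finite) set of real eigenvalues of an operator. -/
noncomputable def eigenvals (A : Op n) : Finset ℝ := (Matrix.finite_real_spectrum (A := A)).toFinset

/-- The spectral projection of a self-adjoint operator at `ω`. -/
noncomputable def spectralProj (A : Op n) (ω : ℝ) : Op n :=
  cfc (fun x : ℝ => if x = ω then (1 : ℝ) else 0) A

end Superoperators

/-! ### Qubits and CSS codes -/

section Codes

/-- The computational basis of the Hilbert space `⨂_{v ∈ Q} ℂ²`. -/
abbrev Config (Q : Type*) : Type _ := Q → Fin 2

/-- The Pauli matrix `X`. -/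
def pauliX : Matrix (Fin 2) (Fin 2) ℂ := !![0, 1; 1, 0]

/-- The Pauli matrix `Z`. -/
def pauliZ : Matrix (Fin 2) (Fin 2) ℂ := !![1, 0; 0, -1]

/-- The tensor product `⨂_v M v` of single-qubit operators. -/
def tensorOp {Q : Type*} [Fintype Q] (M : Q → Matrix (Fin 2) (Fin 2) ℂ) : Op (Config Q) :=
  Matrix.of fun x y => ∏ v, M v (x v) (y v)

/-- The operator acting as `P` on every qubit of `a` and trivially elsewhere. -/
def pauliString {Q : Type*} [Fintype Q] [DecidableEq Q] (P : Matrix (Fin 2) (Fin 2) ℂ)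
    (a : Finset Q) : Op (Config Q) :=
  tensorOp fun v => if v ∈ a then P else 1

/-- A CSS code with qubits `Q`, stars `S` and plaquettes `P`: the supports `d s` of the stars
(carrying Pauli `X`) and `bd p` of the plaquettes (carrying Pauli `Z`), such that star and
plaquette operators commute. -/
structure CSSCode (Q S P : Type*) [Fintype Q] [DecidableEq Q] where
  d : S → Finset Q
  bd : P → Finset Q
  comm : ∀ s p, Commute (pauliString pauliX (d s)) (pauliString pauliZ (bd p))

namespace CSSCode

variable {Q S P : Type*} [Fintype Q] [DecidableEq Q] [Fintype S] [Fintype P]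

/-- The star operator `A_s = ⨂_{v ∈ d s} X_v`. -/
def starOp (C : CSSCode Q S P) (s : S) : Op (Config Q) := pauliString pauliX (C.d s)

/-- The plaquette operator `B_p = ⨂_{v ∈ ∂ p} Z_v`. -/
def plaqOp (C : CSSCode Q S P) (p : P) : Op (Config Q) := pauliString pauliZ (C.bd p)

/-- The operator `-2 ∑_{s ∈ ∂ v} A_s`, summed over the stars containing the qubit `v`. -/
def starField (C : CSSCode Q S P) (v : Q) : Op (Config Q) :=
  (-2 : ℂ) • ∑ s with v ∈ C.d s, C.starOp s

/-- The operator `-2 ∑_{p ∈ d v} B_p`, summed over the plaquettes containing the qubit `v`. -/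
def plaqField (C : CSSCode Q S P) (v : Q) : Op (Config Q) :=
  (-2 : ℂ) • ∑ p with v ∈ C.bd p, C.plaqOp p

end CSSCode

/-- Jump rates at inverse temperature `β`: for every qubit `v` a function of the Bohr frequencies
(the eigenvalues of `field v`), strictly positive and in detailed balance. -/
structure JumpRates {Q : Type*} [Fintype Q] [DecidableEq Q] (β : ℝ)
    (field : Q → Op (Config Q)) where
  rate : Q → ℝ → ℝ
  pos : ∀ v, ∀ ω ∈ eigenvals (field v), 0 < rate v ω
  detailed_balance : ∀ v, ∀ ω ∈ eigenvals (field v),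
    rate v (-ω) = rate v ω * Real.exp (-β * ω)

namespace CSSCode

variable {Q S P : Type*} [Fintype Q] [DecidableEq Q] [Fintype S] [Fintype P] {β : ℝ}

/-- The star part of the Davies Lindbladian, with jump operators `Z_v P_{∂ v}(ω)`. -/
noncomputable def starLindbladian (C : CSSCode Q S P) (h : JumpRates β C.starField) :
    SuperOp (Config Q) :=
  ∑ v, ∑ ω ∈ eigenvals (C.starField v),
    (h.rate v ω : ℂ) • dissipator (pauliString pauliZ {v} * spectralProj (C.starField v) ω)

/-- The plaquette part of the Davies Lindbladian, with jump operators `X_v P_{d v}(ω)`. -/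
noncomputable def plaqLindbladian (C : CSSCode Q S P) (h : JumpRates β C.plaqField) :
    SuperOp (Config Q) :=
  ∑ v, ∑ ω ∈ eigenvals (C.plaqField v),
    (h.rate v ω : ℂ) • dissipator (pauliString pauliX {v} * spectralProj (C.plaqField v) ω)

/-- The full Davies Lindbladian. -/
noncomputable def daviesLindbladian (C : CSSCode Q S P) (hs : JumpRates β C.starField)
    (hp : JumpRates β C.plaqField) : SuperOp (Config Q) :=
  C.starLindbladian hs + C.plaqLindbladian hp

/-- The algebra generated by all star and plaquette operators. -/
def stabilizerAlgebra (C : CSSCode Q S P) : Subalgebra ℂ (Op (Config Q)) :=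
  Algebra.adjoin ℂ (Set.range C.starOp ∪ Set.range C.plaqOp)

/-- `O` commutes with all stars and plaquettes but is not in the algebra they generate. -/
def IsLogical (C : CSSCode Q S P) (O : Op (Config Q)) : Prop :=
  (∀ s, Commute O (C.starOp s)) ∧ (∀ p, Commute O (C.plaqOp p)) ∧ O ∉ C.stabilizerAlgebra

/-- Logical `X`-operators: logical strings of Pauli `X`-operators. -/
def IsLogicalX (C : CSSCode Q S P) (O : Op (Config Q)) : Prop :=
  C.IsLogical O ∧ ∃ a : Finset Q, O = pauliString pauliX a

/-- Logical `Z`-operators: logical strings of Pauli `Z`-operators. -/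
def IsLogicalZ (C : CSSCode Q S P) (O : Op (Config Q)) : Prop :=
  C.IsLogical O ∧ ∃ b : Finset Q, O = pauliString pauliZ b

/-- Logical `Y`-operators: `Y_L = i X_L Z_L`. The pair `X_L`, `Z_L` is arbitrary, which includes
all anticommuting pairs that belong to one logical qubit. -/
def IsLogicalY (C : CSSCode Q S P) (O : Op (Config Q)) : Prop :=
  ∃ X Z, C.IsLogicalX X ∧ C.IsLogicalZ Z ∧ O = Complex.I • (X * Z)

end CSSCode

end Codes

/-! ### Families of CSS codes on a lattice -/

section Lattice

/-- A non-empty rectangle of unit cells of the lattice `ℤ^D`. -/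
structure Rectangle (D : ℕ) where
  lo : Fin D → ℤ
  hi : Fin D → ℤ
  nonempty : lo ≤ hi

namespace Rectangle

variable {D : ℕ}

/-- The unit cells of the rectangle. -/
noncomputable def cells (R : Rectangle D) : Finset (Fin D → ℤ) := Finset.Icc R.lo R.hi

/-- The qubits in the rectangle, each unit cell carrying `q` of them. -/
abbrev Qubit (R : Rectangle D) (q : ℕ) : Type := R.cells × Fin q

/-- The distance of two unit cells in the coordinate direction `i`; the rectangle is closed up
periodically in the directions belonging to `per`. -/
noncomputable def coordDist (R : Rectangle D) (per : Finset (Fin D)) (i : Fin D)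
    (z z' : Fin D → ℤ) : ℤ :=
  if i ∈ per then min |z i - z' i| (R.hi i - R.lo i + 1 - |z i - z' i|) else |z i - z' i|

/-- Distance at most one in the maximum distance of unit cells. -/
def Near (R : Rectangle D) (per : Finset (Fin D)) (z z' : Fin D → ℤ) : Prop :=
  ∀ i, R.coordDist per i z z' ≤ 1

end Rectangle

/-- A CSS code on a rectangle of the `D`-dimensional lattice. Every unit cell carries `q` qubits,
at most `nS` stars and at most `nP` plaquettes (at the boundary, interactions may be truncated or
removed). The support of a star or plaquette has diameter at most one. Each coordinate direction
has either open or periodic boundary conditions. -/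
structure LatticeCSSCode (D q nS nP : ℕ) where
  Λ : Rectangle D
  periodic : Finset (Fin D)
  stars : Finset (Λ.cells × Fin nS)
  plaqs : Finset (Λ.cells × Fin nP)
  code : CSSCode (Λ.Qubit q) stars plaqs
  star_local : ∀ s, ∀ v ∈ code.d s, ∀ v' ∈ code.d s, Λ.Near periodic v.1 v'.1
  plaq_local : ∀ p, ∀ v ∈ code.bd p, ∀ v' ∈ code.bd p, Λ.Near periodic v.1 v'.1

/-- The system size `|Λ|`: the number of qubits. -/
noncomputable def LatticeCSSCode.size {D q nS nP : ℕ} (C : LatticeCSSCode D q nS nP) : ℕ :=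
  Fintype.card (C.Λ.Qubit q)

/-- A family of CSS codes on an increasing sequence of rectangles of the `D`-dimensional
lattice. -/
structure CSSFamily (D q nS nP : ℕ) where
  member : ℕ → LatticeCSSCode D q nS nP
  increasing : Monotone fun k => (member k).Λ.cells

end Lattice

end CSSDavies

namespace CSSDavies

/-! ### Semigroups as power series -/

section Semigroup

variable {n : Type*} [Fintype n] [DecidableEq n]

/-! In the Heisenberg picture the quantity to bound is `Tr (σ e^{tL}(O))`, with `O` a product of an
`X`-string and a `Z`-string up to a phase. The star and plaquette generators commute, since their
jumps commute up to a sign that cancels. `X_L` commutes with all plaquette jumps, and the evolved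
`Z`-string commutes with all star jumps. Hence the evolution factorizes: the star part acts on the
`X`-string and the plaquette part on the `Z`-string (`semigroup_daviesLindbladian_mul`).

Each factor is classical. In the Hadamard basis the star part maps diagonal observables to diagonal
observables and acts there as a spin-flip chain reversible for the Gibbs measure of the stars; the
plaquette part does the same in the computational basis (`FlipRep`, `jumpLindbladian_obs`). The
plaquette chain contracts the sup norm, so the `Z` factor has norm at most one.

For the star chain, the quantum MLSI restricted to diagonal states is the classical MLSI
(`classical_mlsi`), once the long-time limit is identified with the Gibbs state by ergodicity.
Relative entropy then decays like `e^{-2αt}`, and a Pinsker-type bound halves the rate to `α`.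
Started near a point mass, the entropy is at most `-log min μ`, which is linear in the system size;
this is the polynomial prefactor (`abs_flipFlow_le_of_mlsi`, `neg_log_starGibbs_le`).

Decay to zero requires that `X_L` has Gibbs mean zero. The Gibbs weight lies in the star algebra,
which is spanned by products of stars, and each of these is trace-orthogonal to an `X`-string
outside the stabilizer algebra (`sum_starGibbs_mul_character`). -/

theorem hasSum_semigroup (S : SuperOp n) (t : ℝ) (A : Op n) :
    HasSum (fun k : ℕ => ((k.factorial : ℂ)⁻¹ * (t : ℂ) ^ k) • (S ^ k) A) (semigroup S t A) := by
  set e := LinearMap.toMatrixAlgEquiv (Matrix.stdBasis ℂ n n) with he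
  have h1 : HasSum (fun k : ℕ => ((k.factorial : ℂ)⁻¹) • ((t : ℂ) • e S) ^ k)
      (NormedSpace.exp ((t : ℂ) • e S)) := by
    open scoped Matrix.Norms.Operator in
    exact NormedSpace.exp_series_hasSum_exp' (𝕂 := ℂ) ((t : ℂ) • e S)
  let T : Matrix (n × n) (n × n) ℂ →ₗ[ℂ] Op n :=
    { toFun := fun M => e.symm M A
      map_add' := fun M N => by simp
      map_smul' := fun c M => by simp }
  have hT : Continuous T := T.continuous_of_finiteDimensional
  have h2 := h1.map T hT
  have h3 : HasSum (fun k : ℕ => ((k.factorial : ℂ)⁻¹ * (t : ℂ) ^ k) • (S ^ k) A)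
      (T (NormedSpace.exp ((t : ℂ) • e S))) := by
    convert h2 using 1
    ext1 k
    simp only [Function.comp_apply, map_smul, smul_pow, smul_smul]
    congr 1
    simp [T]
  exact h3

/-- Intertwining passes through each power and hence through the series. It serves with `T` a left
or right multiplication, to pull commuting factors out of the evolution. -/
theorem semigroup_map {m : Type*} [Fintype m] [DecidableEq m] {S : SuperOp n} {S' : SuperOp m}
    (T : Op n →ₗ[ℂ] Op m) (h : ∀ A, T (S A) = S' (T A)) (t : ℝ) (A : Op n) :
    T (semigroup S t A) = semigroup S' t (T A) := by
  have hk : ∀ k : ℕ, T ((S ^ k) A) = (S' ^ k) (T A) := by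
    intro k
    induction k with
    | zero => simp
    | succ k ih => rw [pow_succ', pow_succ', Module.End.mul_apply, Module.End.mul_apply, h, ih]
  have h1 := (hasSum_semigroup S t A).map T T.continuous_of_finiteDimensional
  refine h1.unique ?_
  convert hasSum_semigroup S' t (T A) using 1
  ext1 k
  simp [hk]

theorem hasSum_exp_smul_apply {V : Type*} [NormedAddCommGroup V] [NormedSpace ℝ V]
    [CompleteSpace V] (G : V →L[ℝ] V) (t : ℝ) (f : V) :
    HasSum (fun k : ℕ => ((k.factorial : ℝ)⁻¹ * t ^ k) • (G ^ k) f)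
      (NormedSpace.exp (t • G) f) := by
  have h1 := (NormedSpace.exp_series_hasSum_exp' (𝕂 := ℝ) (t • G)).map
    (ContinuousLinearMap.apply ℝ V f) (ContinuousLinearMap.continuous _)
  have h2 : HasSum (fun k : ℕ => ((k.factorial : ℝ)⁻¹ * t ^ k) • (G ^ k) f)
      (ContinuousLinearMap.apply ℝ V f (NormedSpace.exp (t • G))) := by
    convert h1 using 1
    ext1 k
    simp [smul_pow, smul_smul]
  exact h2

/-- Classical counterpart of `semigroup_map`. A zero generator on one side yields conservation laws:
constants are fixed and the invariant measure is preserved. -/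
theorem map_exp_smul_apply {V W : Type*} [NormedAddCommGroup V] [NormedSpace ℝ V]
    [CompleteSpace V] [NormedAddCommGroup W] [NormedSpace ℝ W] [CompleteSpace W]
    {G : V →L[ℝ] V} {H : W →L[ℝ] W} (T : V →L[ℝ] W) (h : ∀ f, T (G f) = H (T f))
    (t : ℝ) (f : V) :
    T (NormedSpace.exp (t • G) f) = NormedSpace.exp (t • H) (T f) := by
  have hk : ∀ k : ℕ, T ((G ^ k) f) = (H ^ k) (T f) := by
    intro k
    induction k with
    | zero => simp
    | succ k ih =>
      rw [pow_succ', pow_succ']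
      exact (h _).trans (congrArg H ih)
  refine ((hasSum_exp_smul_apply G t f).map T T.continuous).unique ?_
  convert hasSum_exp_smul_apply H t (T f) using 1
  ext1 k
  simp [← hk]

/-- The bridge from quantum to classical: the range of `T` is an invariant real subspace on which
the superoperator acts as the generator of a Markov chain. -/
theorem semigroup_apply_of_intertwine {V : Type*} [NormedAddCommGroup V] [NormedSpace ℝ V]
    [FiniteDimensional ℝ V] [CompleteSpace V] {S : SuperOp n} {G : V →L[ℝ] V}
    (T : V →ₗ[ℝ] Op n) (h : ∀ f, S (T f) = T (G f)) (t : ℝ) (f : V) :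
    semigroup S t (T f) = T (NormedSpace.exp (t • G) f) := by
  have hk : ∀ k : ℕ, T ((G ^ k) f) = (S ^ k) (T f) := by
    intro k
    induction k with
    | zero => simp
    | succ k ih =>
      rw [pow_succ', pow_succ']
      exact (h _).symm.trans (congrArg S ih)
  have h1 := (hasSum_exp_smul_apply G t f).map T T.continuous_of_finiteDimensional
  refine (hasSum_semigroup S t (T f)).unique ?_
  convert h1 using 1
  ext1 k
  simp only [Function.comp_apply, map_smul, hk]
  ext i j
  simp

/-- For Hermiticity-preserving maps the sesquilinear adjoint is also the adjoint of the bilinear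
trace pairing, which is the pairing of states with observables. -/
theorem trace_hsAdjoint_mul {S : SuperOp n} (hS : ∀ A, S A.conjTranspose = (S A).conjTranspose)
    (A B : Op n) : (hsAdjoint S A * B).trace = (A * S B).trace := by
  have h := trace_hsAdjoint S A B.conjTranspose
  rw [hS, ← Matrix.conjTranspose_mul, ← Matrix.conjTranspose_mul, Matrix.trace_conjTranspose,
    Matrix.trace_conjTranspose] at h
  have h' := star_injective h
  rw [Matrix.trace_mul_comm, h', Matrix.trace_mul_comm]

theorem hsAdjoint_eq_of_trace {S : SuperOp n} {A A' : Op n}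
    (h : ∀ B, (A'.conjTranspose * B).trace = (A.conjTranspose * S B).trace) :
    hsAdjoint S A = A' := by
  have h1 : ∀ B, ((hsAdjoint S A).conjTranspose * B).trace = (A'.conjTranspose * B).trace :=
    fun B => (trace_hsAdjoint S A B).trans (h B).symm
  have h2 := Matrix.ext_iff_trace_mul_right.2 h1
  exact Matrix.conjTranspose_injective h2

theorem trace_evolve_mul {S : SuperOp n} (hS : ∀ A, S A.conjTranspose = (S A).conjTranspose)
    (t : ℝ) (A B : Op n) : (evolve S t A * B).trace = (A * semigroup S t B).trace := by
  have hk : ∀ k : ℕ, ∀ A, ((hsAdjoint S ^ k) A * B).trace = (A * (S ^ k) B).trace := by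
    intro k
    induction k with
    | zero => simp
    | succ k ih =>
      intro A
      rw [pow_succ, Module.End.mul_apply, ih, trace_hsAdjoint_mul hS, pow_succ',
        Module.End.mul_apply]
  let T₁ : Op n →ₗ[ℂ] ℂ := Matrix.traceLinearMap n ℂ ℂ ∘ₗ LinearMap.mulRight ℂ B
  let T₂ : Op n →ₗ[ℂ] ℂ := Matrix.traceLinearMap n ℂ ℂ ∘ₗ LinearMap.mulLeft ℂ A
  have h1 := (hasSum_semigroup (hsAdjoint S) t A).map T₁ T₁.continuous_of_finiteDimensional
  have h2 := (hasSum_semigroup S t B).map T₂ T₂.continuous_of_finiteDimensional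
  refine h1.unique (?_ : HasSum _ (T₂ (semigroup S t B)))
  convert h2 using 1
  ext1 k
  simp only [Function.comp_apply, map_smul]
  exact congrArg _ (hk k A)

theorem semigroup_add_of_commute {S T : SuperOp n} (h : Commute S T) (t : ℝ) (A : Op n) :
    semigroup (S + T) t A = semigroup S t (semigroup T t A) := by
  unfold semigroup
  rw [map_add, smul_add, Matrix.exp_add_of_commute, map_mul, Module.End.mul_apply]
  exact (((h.map (LinearMap.toMatrixAlgEquiv (Matrix.stdBasis ℂ n n))).smul_left _).smul_right _)

end Semigroup

end CSSDavies

namespace CSSDavies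

/-! ### Reversible spin-flip chains -/

section Chain

/-- An inequality of Grönwall type. -/
theorem le_exp_mul_of_hasDerivAt {V V' : ℝ → ℝ} {c : ℝ} (hV : ∀ t, 0 ≤ t → HasDerivAt V (V' t) t)
    (h : ∀ t, 0 ≤ t → V' t ≤ -c * V t) {t : ℝ} (ht : 0 ≤ t) :
    V t ≤ Real.exp (-c * t) * V 0 := by
  have hd : ∀ s, 0 ≤ s → HasDerivAt (fun s => Real.exp (c * s) * V s)
      (Real.exp (c * s) * (c * 1) * V s + Real.exp (c * s) * V' s) s := fun s hs =>
    (((hasDerivAt_id s).const_mul c).exp).mul (hV s hs)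
  have hanti : AntitoneOn (fun s => Real.exp (c * s) * V s) (Set.Ici 0) := by
    refine antitoneOn_of_deriv_nonpos (convex_Ici 0)
      (fun s hs => (hd s hs).continuousAt.continuousWithinAt)
      (fun s hs => ?_) (fun s hs => ?_)
    · rw [interior_Ici] at hs
      exact (hd s (le_of_lt hs)).differentiableAt.differentiableWithinAt
    · rw [interior_Ici] at hs
      rw [(hd s (le_of_lt hs)).deriv]
      have := mul_le_mul_of_nonneg_left (h s (le_of_lt hs)) (Real.exp_pos (c * s)).le
      linarith
  have h0 := hanti (Set.mem_Ici.2 le_rfl) (Set.mem_Ici.2 ht) ht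
  simp only [mul_zero, Real.exp_zero, one_mul] at h0
  have h1 : Real.exp (-c * t) * (Real.exp (c * t) * V t) = V t := by
    rw [← mul_assoc, ← Real.exp_add]
    simp
  rw [← h1]
  exact mul_le_mul_of_nonneg_left h0 (Real.exp_pos _).le

variable {Q X : Type*} [Fintype Q] [Fintype X]

/-- The generator `G f (x) = ∑ v, r v x (f (flip v x) - f x)` of a continuous-time Markov chain. -/
noncomputable def flipGenerator (flip : Q → X → X) (r : Q → X → ℝ) : (X → ℝ) →L[ℝ] (X → ℝ) :=
  LinearMap.toContinuousLinearMap
    { toFun := fun f x => ∑ v, r v x * (f (flip v x) - f x)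
      map_add' := fun f g => by
        ext x
        simp only [Pi.add_apply, ← Finset.sum_add_distrib]
        exact Finset.sum_congr rfl fun v _ => by ring
      map_smul' := fun c f => by
        ext x
        simp only [Pi.smul_apply, smul_eq_mul, Finset.mul_sum, RingHom.id_apply]
        exact Finset.sum_congr rfl fun v _ => by ring }

theorem flipGenerator_apply (flip : Q → X → X) (r : Q → X → ℝ) (f : X → ℝ) (x : X) :
    flipGenerator flip r f x = ∑ v, r v x * (f (flip v x) - f x) := rfl

/-- The Markov semigroup of a spin-flip chain. -/
noncomputable def flipFlow (flip : Q → X → X) (r : Q → X → ℝ) (t : ℝ) : (X → ℝ) →L[ℝ] (X → ℝ) :=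
  NormedSpace.exp (t • flipGenerator flip r)

variable {flip : Q → X → X} {r : Q → X → ℝ}

theorem flipFlow_zero (f : X → ℝ) : flipFlow flip r 0 f = f := by
  simp [flipFlow]

theorem hasDerivAt_flipFlow (f : X → ℝ) (t : ℝ) :
    HasDerivAt (fun s => flipFlow flip r s f) (flipGenerator flip r (flipFlow flip r t f)) t :=
  (ContinuousLinearMap.apply ℝ (X → ℝ) f).hasFDerivAt.comp_hasDerivAt t
    (hasDerivAt_exp_smul_const' (𝕂 := ℝ) (flipGenerator flip r) t)

theorem hasDerivAt_flipFlow_apply (f : X → ℝ) (t : ℝ) (x : X) :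
    HasDerivAt (fun s => flipFlow flip r s f x) (flipGenerator flip r (flipFlow flip r t f) x) t :=
  hasDerivAt_pi.1 (hasDerivAt_flipFlow f t) x

theorem flipFlow_const (t c : ℝ) : flipFlow flip r t (fun _ => c) = fun _ => c := by
  let T : ℝ →L[ℝ] (X → ℝ) := (ContinuousLinearMap.id ℝ ℝ).smulRight (fun _ => (1 : ℝ))
  have h := map_exp_smul_apply (G := 0) (H := flipGenerator flip r) T (fun f => by
    ext x
    simp [T, flipGenerator_apply]) t c
  have hT : T c = fun _ => c := by
    ext x
    simp [T]
  rw [smul_zero, NormedSpace.exp_zero, one_apply_eq_self, hT] at h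
  exact h.symm

/-- Uniformization: adding a large multiple `c` of the identity makes all matrix entries of the
generator nonnegative, and `e^{tG} = e^{-tc} e^{t(G + c)}`. -/
theorem flipFlow_nonneg (hr : ∀ v x, 0 ≤ r v x) {t : ℝ} (ht : 0 ≤ t) {f : X → ℝ}
    (hf : ∀ x, 0 ≤ f x) (x : X) : 0 ≤ flipFlow flip r t f x := by
  -- Summing over `x` as well gives one constant that dominates the total exit rate at every
  -- configuration.
  set c : ℝ := ∑ v, ∑ x, r v x
  set K : (X → ℝ) →L[ℝ] (X → ℝ) := flipGenerator flip r + c • 1 with hK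
  have hKf : ∀ f : X → ℝ, (∀ x, 0 ≤ f x) → ∀ x, 0 ≤ K f x := by
    intro f hf x
    have h1 : K f x = ∑ v, r v x * f (flip v x) + (c - ∑ v, r v x) * f x := by
      simp only [hK, add_apply, Pi.add_apply, flipGenerator_apply, mul_sub,
        Finset.sum_sub_distrib, smul_apply, one_apply_eq_self,
        Pi.smul_apply, smul_eq_mul, sub_mul, Finset.sum_mul]
      ring
    have h2 : ∑ v, r v x ≤ c := Finset.sum_le_sum fun v _ =>
      Finset.single_le_sum (f := fun x => r v x) (fun y _ => hr v y) (Finset.mem_univ x)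
    rw [h1]
    exact add_nonneg (Finset.sum_nonneg fun v _ => mul_nonneg (hr v x) (hf _))
      (mul_nonneg (sub_nonneg.2 h2) (hf x))
  have hpow : ∀ k : ℕ, ∀ x, 0 ≤ (K ^ k) f x := by
    intro k
    induction k with
    | zero => simpa using hf
    | succ k ih =>
      rw [pow_succ']
      exact hKf _ ih
  have hexp : flipFlow flip r t = Real.exp (-(t * c)) • NormedSpace.exp (t • K) := by
    have h1 : t • flipGenerator flip r = algebraMap ℝ _ (-(t * c)) + t • K := by
      rw [hK, Algebra.algebraMap_eq_smul_one, smul_add, smul_smul, neg_smul]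
      abel
    let _ : NormedAlgebra ℚ ((X → ℝ) →L[ℝ] (X → ℝ)) := NormedAlgebra.restrictScalars ℚ ℝ _
    rw [flipFlow, h1, NormedSpace.exp_add_of_commute (Algebra.commutes _ _),
      ← NormedSpace.algebraMap_exp_comm, ← Real.exp_eq_exp_ℝ, ← Algebra.smul_def]
  have hsum := (hasSum_exp_smul_apply K t f).map
    (ContinuousLinearMap.proj (R := ℝ) (φ := fun _ : X => ℝ) x) (ContinuousLinearMap.continuous _)
  have h0 : 0 ≤ NormedSpace.exp (t • K) f x := by
    refine hsum.nonneg fun k => ?_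
    exact mul_nonneg (mul_nonneg (by positivity) (pow_nonneg ht k)) (hpow k x)
  rw [hexp]
  exact mul_nonneg (Real.exp_pos _).le h0

theorem le_flipFlow (hr : ∀ v x, 0 ≤ r v x) {t : ℝ} (ht : 0 ≤ t) {f : X → ℝ} {m : ℝ}
    (hf : ∀ x, m ≤ f x) (x : X) : m ≤ flipFlow flip r t f x := by
  have h := flipFlow_nonneg (flip := flip) hr ht (f := f - fun _ => m)
    (fun x => sub_nonneg.2 (hf x)) x
  rw [map_sub, flipFlow_const] at h
  exact sub_nonneg.1 h

theorem abs_flipFlow_le (hr : ∀ v x, 0 ≤ r v x) {t : ℝ} (ht : 0 ≤ t) {f : X → ℝ} {M : ℝ}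
    (hf : ∀ x, |f x| ≤ M) (x : X) : |flipFlow flip r t f x| ≤ M := by
  have h1 := le_flipFlow (flip := flip) hr ht (fun x => (abs_le.1 (hf x)).1) x
  have h2 := le_flipFlow (flip := flip) hr ht (f := -f) (m := -M)
    (fun x => neg_le_neg (abs_le.1 (hf x)).2) x
  rw [map_neg, Pi.neg_apply] at h2
  exact abs_le.2 ⟨h1, neg_le_neg_iff.1 h2⟩

theorem flipFlow_pos (hr : ∀ v x, 0 ≤ r v x) {t : ℝ} (ht : 0 ≤ t) {f : X → ℝ}
    (hf : ∀ x, 0 < f x) (x : X) : 0 < flipFlow flip r t f x := by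
  obtain ⟨y, -, hy⟩ := Finset.exists_min_image Finset.univ f ⟨x, Finset.mem_univ x⟩
  exact (hf y).trans_le (le_flipFlow hr ht (fun z => hy z (Finset.mem_univ z)) x)

section Reversible

variable {μ : X → ℝ} (hflip : ∀ v, Function.Involutive (flip v))
  (hrev : ∀ v x, μ (flip v x) * r v (flip v x) = μ x * r v x)
include hflip hrev

/-- The Dirichlet form of a reversible spin-flip chain. -/
theorem sum_mul_flipGenerator (f g : X → ℝ) :
    ∑ x, μ x * f x * flipGenerator flip r g x
      = -(1 / 2) * ∑ v, ∑ x, μ x * r v x * ((f (flip v x) - f x) * (g (flip v x) - g x)) := by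
  have h1 : ∑ x, μ x * f x * flipGenerator flip r g x
      = ∑ v, ∑ x, μ x * r v x * (f x * (g (flip v x) - g x)) := by
    simp only [flipGenerator_apply, Finset.mul_sum]
    rw [Finset.sum_comm]
    exact Finset.sum_congr rfl fun v _ => Finset.sum_congr rfl fun x _ => by ring
  rw [h1, Finset.mul_sum]
  refine Finset.sum_congr rfl fun v _ => ?_
  -- The substitution `x ↦ flip v x` together with detailed balance; averaging both expressions
  -- symmetrizes the form.
  have h2 : ∑ x, μ x * r v x * (f x * (g (flip v x) - g x))
      = ∑ x, μ x * r v x * (f (flip v x) * (g x - g (flip v x))) := by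
    refine (Equiv.sum_comp (hflip v).toPerm _).symm.trans (Finset.sum_congr rfl fun x _ => ?_)
    change μ (flip v x) * r v (flip v x) *
      (f (flip v x) * (g (flip v (flip v x)) - g (flip v x))) = _
    rw [hflip v x, hrev]
  have h3 : ∑ x, μ x * r v x * ((f (flip v x) - f x) * (g (flip v x) - g x))
      = -∑ x, μ x * r v x * (f (flip v x) * (g x - g (flip v x)))
        - ∑ x, μ x * r v x * (f x * (g (flip v x) - g x)) := by
    rw [← Finset.sum_neg_distrib, ← Finset.sum_sub_distrib]
    exact Finset.sum_congr rfl fun x _ => by ring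
  rw [h3, ← h2]
  ring

theorem sum_mul_flipGenerator_comm (f g : X → ℝ) :
    ∑ x, μ x * f x * flipGenerator flip r g x = ∑ x, μ x * g x * flipGenerator flip r f x := by
  rw [sum_mul_flipGenerator hflip hrev, sum_mul_flipGenerator hflip hrev]
  simp only [mul_comm]

theorem sum_flipGenerator (f : X → ℝ) : ∑ x, μ x * flipGenerator flip r f x = 0 := by
  have := sum_mul_flipGenerator hflip hrev (fun _ => 1) f
  simpa using this

theorem sum_flipFlow (t : ℝ) (f : X → ℝ) : ∑ x, μ x * flipFlow flip r t f x = ∑ x, μ x * f x := by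
  let T : (X → ℝ) →L[ℝ] ℝ := LinearMap.toContinuousLinearMap
    { toFun := fun f => ∑ x, μ x * f x
      map_add' := fun f g => by simp [mul_add, Finset.sum_add_distrib]
      map_smul' := fun c f => by simp [Finset.mul_sum, mul_left_comm] }
  have h := map_exp_smul_apply (G := flipGenerator flip r) (H := 0) T
    (fun f => sum_flipGenerator hflip hrev f) t f
  rw [smul_zero, NormedSpace.exp_zero, one_apply_eq_self] at h
  exact h

/-- Self-adjointness in `ℓ²(μ)` is inherited by the semigroup. It later moves the flow from an
observable to an initial density. -/
theorem sum_mul_flipFlow_comm (t : ℝ) (f g : X → ℝ) :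
    ∑ x, μ x * f x * flipFlow flip r t g x = ∑ x, μ x * g x * flipFlow flip r t f x := by
  let T : (X → ℝ) → (X → ℝ) →L[ℝ] ℝ := fun f => LinearMap.toContinuousLinearMap
    { toFun := fun g => ∑ x, μ x * f x * g x
      map_add' := fun f g => by simp [mul_add, Finset.sum_add_distrib]
      map_smul' := fun c f => by simp [Finset.mul_sum, mul_left_comm] }
  have hT : ∀ f g, T f g = ∑ x, μ x * f x * g x := fun f g => rfl
  have hTc : ∀ f g, T f g = T g f := fun f g => by
    rw [hT, hT]
    exact Finset.sum_congr rfl fun x _ => by ring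
  set G := flipGenerator flip r with hG
  have hk : ∀ k : ℕ, ∀ f g, T f ((G ^ k) g) = T g ((G ^ k) f) := by
    intro k
    induction k with
    | zero => exact fun f g => hTc f g
    | succ k ih =>
      intro f g
      have h1 : T f ((G ^ (k + 1)) g) = T f ((G ^ k) (G g)) := by rw [pow_succ]; rfl
      have h2 : T g ((G ^ (k + 1)) f) = T g (G ((G ^ k) f)) := by rw [pow_succ']; rfl
      rw [h1, h2, ih, hTc]
      exact sum_mul_flipGenerator_comm hflip hrev ((G ^ k) f) g
  have h1 := (hasSum_exp_smul_apply G t g).map (T f) (T f).continuous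
  have h2 := (hasSum_exp_smul_apply G t f).map (T g) (T g).continuous
  refine h1.unique (?_ : HasSum _ (T g (NormedSpace.exp (t • G) f)))
  convert h2 using 1
  ext1 k
  simp only [Function.comp_apply, map_smul, hk k f g]

end Reversible

end Chain
end CSSDavies

namespace CSSDavies

/-! ### Ergodicity, entropy decay and decay of mean-zero observables -/

section Convergence

variable {Q X : Type*} [Fintype Q] [Fintype X]
variable {flip : Q → X → X} {r : Q → X → ℝ} {μ : X → ℝ}
  (hflip : ∀ v, Function.Involutive (flip v))
  (hrev : ∀ v x, μ (flip v x) * r v (flip v x) = μ x * r v x)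
  (hμ : ∀ x, 0 < μ x) (hr : ∀ v x, 0 < r v x) (hμ1 : ∑ x, μ x = 1)
  (hconn : ∀ f : X → ℝ, (∀ v x, f (flip v x) = f x) → ∀ x y, f x = f y)
include hflip hrev hμ hr hμ1 hconn

/-- The Poincaré inequality of an irreducible reversible spin-flip chain. -/
theorem exists_spectral_gap : ∃ c : ℝ, 0 < c ∧ ∀ f : X → ℝ, ∑ x, μ x * f x = 0 →
    2 * ∑ x, μ x * f x * flipGenerator flip r f x ≤ -c * ∑ x, μ x * f x ^ 2 := by
  set E : (X → ℝ) → ℝ := fun f => -∑ x, μ x * f x * flipGenerator flip r f x with hE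
  have hE' : ∀ f, E f = 1 / 2 * ∑ v, ∑ x, μ x * r v x * (f (flip v x) - f x) ^ 2 := fun f => by
    simp only [hE, sum_mul_flipGenerator hflip hrev, sq]
    ring
  have hEc : Continuous E := by
    have : ∀ x, Continuous fun f : X → ℝ => flipGenerator flip r f x := fun x =>
      (continuous_apply x).comp (flipGenerator flip r).continuous
    fun_prop
  -- Compactness replaces an explicit gap: on mean-zero functions of unit sup norm the energy is
  -- continuous, and it is positive because zero energy forces flip invariance, hence constancy,
  -- hence `f = 0`.
  set K : Set (X → ℝ) := Metric.sphere 0 1 ∩ {f | ∑ x, μ x * f x = 0} with hK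
  have hKc : IsCompact K := (isCompact_sphere _ _).inter_right
    (isClosed_eq (by fun_prop) continuous_const)
  have hEpos : ∀ f ∈ K, 0 < E f := by
    rintro f ⟨hf1, hf0⟩
    have hterm : ∀ v x, 0 ≤ μ x * r v x * (f (flip v x) - f x) ^ 2 := fun v x =>
      mul_nonneg (mul_pos (hμ x) (hr v x)).le (sq_nonneg _)
    have h0 : 0 ≤ E f := by
      rw [hE']
      exact mul_nonneg (by norm_num)
        (Finset.sum_nonneg fun v _ => Finset.sum_nonneg fun x _ => hterm v x)
    refine lt_of_le_of_ne h0 fun h => ?_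
    have h1 : ∑ v, ∑ x, μ x * r v x * (f (flip v x) - f x) ^ 2 = 0 := by
      rw [hE'] at h
      linarith
    have h2 : ∀ v x, f (flip v x) = f x := by
      intro v x
      have h3 := (Finset.sum_eq_zero_iff_of_nonneg
        (fun v _ => Finset.sum_nonneg fun x _ => hterm v x)).1 h1 v (Finset.mem_univ v)
      have h4 := (Finset.sum_eq_zero_iff_of_nonneg (fun x _ => hterm v x)).1 h3 x
        (Finset.mem_univ x)
      have h5 := (mul_eq_zero.1 h4).resolve_left (mul_pos (hμ x) (hr v x)).ne'
      exact sub_eq_zero.1 (pow_eq_zero_iff (two_ne_zero)|>.1 h5)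
    have h6 : f = 0 := by
      ext x
      have h7 : ∑ y, μ y * f y = f x := by
        rw [Finset.sum_congr rfl fun y _ => by rw [hconn f h2 y x], ← Finset.sum_mul, hμ1, one_mul]
      rw [← h7]
      exact hf0
    rw [h6] at hf1
    simp at hf1
  obtain ⟨m, hm, hmK⟩ : ∃ m : ℝ, 0 < m ∧ ∀ f ∈ K, m ≤ E f := by
    -- On a one-point space there are no nonzero mean-zero functions, and any positive constant
    -- works.
    rcases K.eq_empty_or_nonempty with h | h
    · exact ⟨1, one_pos, fun f hf => by simp [h] at hf⟩
    · obtain ⟨g, hg, hmin⟩ := hKc.exists_isMinOn h hEc.continuousOn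
      exact ⟨E g, hEpos g hg, fun f hf => hmin hf⟩
  refine ⟨2 * m, by positivity, fun f hf => ?_⟩
  have hV : ∑ x, μ x * f x ^ 2 ≤ ‖f‖ ^ 2 := by
    calc ∑ x, μ x * f x ^ 2 ≤ ∑ x, μ x * ‖f‖ ^ 2 := by
          refine Finset.sum_le_sum fun x _ => mul_le_mul_of_nonneg_left ?_ (hμ x).le
          rw [← sq_abs]
          exact pow_le_pow_left₀ (abs_nonneg _) (norm_le_pi_norm f x) 2
      _ = ‖f‖ ^ 2 := by rw [← Finset.sum_mul, hμ1, one_mul]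
  have hEf : m * ‖f‖ ^ 2 ≤ E f := by
    rcases eq_or_ne f 0 with rfl | hne
    · simp [hE]
    · have hn : ‖f‖ ≠ 0 := norm_ne_zero_iff.2 hne
      have hmem : ‖f‖⁻¹ • f ∈ K := by
        refine ⟨?_, ?_⟩
        · rw [mem_sphere_zero_iff_norm, norm_smul, norm_inv, norm_norm, inv_mul_cancel₀ hn]
        · have : ∑ x, μ x * (‖f‖⁻¹ • f) x = ‖f‖⁻¹ * ∑ x, μ x * f x := by
            simp [Finset.mul_sum, mul_left_comm]
          rw [Set.mem_ofPred_eq, this, hf, mul_zero]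
      have h1 := hmK _ hmem
      have h2 : E (‖f‖⁻¹ • f) = (‖f‖ ^ 2)⁻¹ * E f := by
        have h3 : ∑ v, ∑ x, μ x * r v x * ((‖f‖⁻¹ • f) (flip v x) - (‖f‖⁻¹ • f) x) ^ 2
            = (‖f‖ ^ 2)⁻¹ * ∑ v, ∑ x, μ x * r v x * (f (flip v x) - f x) ^ 2 := by
          simp only [Finset.mul_sum, Pi.smul_apply, smul_eq_mul, ← inv_pow]
          exact Finset.sum_congr rfl fun v _ => Finset.sum_congr rfl fun x _ => by ring
        rw [hE', hE', h3]
        ring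
      rw [h2] at h1
      have h3 : 0 < ‖f‖ ^ 2 := by positivity
      rw [inv_mul_eq_div, le_div_iff₀ h3] at h1
      exact h1
  have h4 := mul_le_mul_of_nonneg_left hV hm.le
  have h5 : ∑ x, μ x * f x * flipGenerator flip r f x = -E f := by simp [hE]
  rw [h5]
  linarith

/-- The gap makes the variance decay, and `μ x > 0` turns this into pointwise convergence. The rate
may depend badly on the system size; only the value of the limit is needed, to identify the
long-time limit with the Gibbs state. -/
theorem tendsto_flipFlow (f : X → ℝ) (x : X) :
    Filter.Tendsto (fun t => flipFlow flip r t f x) Filter.atTop (nhds (∑ y, μ y * f y)) := by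
  obtain ⟨c, hc, hgap⟩ := exists_spectral_gap hflip hrev hμ hr hμ1 hconn
  set m := ∑ y, μ y * f y with hm
  set g : X → ℝ := f - fun _ => m with hg
  have hg0 : ∑ y, μ y * g y = 0 := by
    simp [hg, mul_sub, ← Finset.sum_mul, hμ1, ← hm]
  have hd : ∀ t, 0 ≤ t → HasDerivAt (fun t => ∑ y, μ y * flipFlow flip r t g y ^ 2)
      (2 * ∑ y, μ y * flipFlow flip r t g y * flipGenerator flip r (flipFlow flip r t g) y) t := by
    intro t _
    rw [Finset.mul_sum]
    refine HasDerivAt.fun_sum fun y _ => ?_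
    refine (((hasDerivAt_flipFlow_apply g t y).pow 2).const_mul (μ y)).congr_deriv ?_
    push_cast
    ring
  have hV : ∀ t, 0 ≤ t → ∑ y, μ y * flipFlow flip r t g y ^ 2
      ≤ Real.exp (-c * t) * ∑ y, μ y * flipFlow flip r 0 g y ^ 2 := fun t ht =>
    le_exp_mul_of_hasDerivAt hd (fun t _ => hgap _ (by rw [sum_flipFlow hflip hrev, hg0])) ht
  have h1 : Filter.Tendsto (fun t => Real.exp (-c * t) * ∑ y, μ y * flipFlow flip r 0 g y ^ 2)
      Filter.atTop (nhds 0) := by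
    have : Filter.Tendsto (fun t : ℝ => Real.exp (-c * t)) Filter.atTop (nhds 0) :=
      Real.tendsto_exp_atBot.comp (Filter.tendsto_id.const_mul_atTop_of_neg (by linarith))
    simpa using this.mul_const (∑ y, μ y * flipFlow flip r 0 g y ^ 2)
  have h2 : Filter.Tendsto (fun t => μ x * flipFlow flip r t g x ^ 2) Filter.atTop (nhds 0) := by
    refine squeeze_zero' (Filter.Eventually.of_forall fun t => mul_nonneg (hμ x).le (sq_nonneg _))
      ?_ h1
    filter_upwards [Filter.eventually_ge_atTop 0] with t ht
    exact (Finset.single_le_sum (f := fun y => μ y * flipFlow flip r t g y ^ 2)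
      (fun y _ => mul_nonneg (hμ y).le (sq_nonneg _)) (Finset.mem_univ x)).trans (hV t ht)
  have h3 : Filter.Tendsto (fun t => flipFlow flip r t g x) Filter.atTop (nhds 0) := by
    have h4 : Filter.Tendsto (fun t => flipFlow flip r t g x ^ 2) Filter.atTop (nhds 0) := by
      have := h2.const_mul (μ x)⁻¹
      simpa [← mul_assoc, inv_mul_cancel₀ (hμ x).ne'] using this
    have h5 := h4.sqrt
    simp only [Real.sqrt_sq_eq_abs, Real.sqrt_zero] at h5
    exact (tendsto_zero_iff_abs_tendsto_zero _).2 h5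
  have h6 := h3.add_const m
  rw [zero_add] at h6
  refine h6.congr fun t => ?_
  rw [hg, map_sub, flipFlow_const]
  simp

omit hμ hμ1 hconn in
/-- Decay of the relative entropy under a classical modified logarithmic Sobolev inequality. -/
theorem entropy_flipFlow_le {α : ℝ}
    (hmlsi : ∀ f : X → ℝ, (∀ x, 0 < f x) → ∑ x, μ x * f x = 1 →
      2 * α * ∑ x, μ x * f x * Real.log (f x)
        ≤ -∑ x, μ x * flipGenerator flip r f x * Real.log (f x))
    {f : X → ℝ} (hf : ∀ x, 0 < f x) (hf1 : ∑ x, μ x * f x = 1) {t : ℝ} (ht : 0 ≤ t) :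
    ∑ x, μ x * flipFlow flip r t f x * Real.log (flipFlow flip r t f x)
      ≤ Real.exp (-(2 * α) * t) * ∑ x, μ x * f x * Real.log (f x) := by
  have hr0 : ∀ v x, 0 ≤ r v x := fun v x => (hr v x).le
  have hd : ∀ t, 0 ≤ t → HasDerivAt
      (fun t => ∑ x, μ x * flipFlow flip r t f x * Real.log (flipFlow flip r t f x))
      (∑ x, μ x * flipGenerator flip r (flipFlow flip r t f) x
        * Real.log (flipFlow flip r t f x)) t := by
    intro t ht
    -- Differentiating `f log f` produces the extra term `G f`, which integrates to zero by
    -- invariance of `μ`.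
    have h0 : ∑ x, μ x * flipGenerator flip r (flipFlow flip r t f) x
        * Real.log (flipFlow flip r t f x) = ∑ x, (μ x * flipGenerator flip r (flipFlow flip r t f) x
        * Real.log (flipFlow flip r t f x) + μ x * flipGenerator flip r (flipFlow flip r t f) x) := by
      rw [Finset.sum_add_distrib, sum_flipGenerator hflip hrev, add_zero]
    rw [h0]
    refine HasDerivAt.fun_sum fun x _ => ?_
    have hp := flipFlow_pos (flip := flip) hr0 ht hf x
    have h1 := hasDerivAt_flipFlow_apply (flip := flip) (r := r) f t x
    refine ((h1.const_mul (μ x)).mul (h1.log hp.ne')).congr_deriv ?_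
    field_simp
  have h := le_exp_mul_of_hasDerivAt (c := 2 * α) hd (fun t ht => ?_) ht
  · simpa only [flipFlow_zero] using h
  · have := hmlsi (flipFlow flip r t f) (flipFlow_pos hr0 ht hf)
      (by rw [sum_flipFlow hflip hrev, hf1])
    linarith

omit hflip hrev hr hconn in
/-- A bound of the total variation distance by the relative entropy. -/
theorem abs_sum_le_sqrt_entropy {f g : X → ℝ} (hf : ∀ x, 0 < f x) (hf1 : ∑ x, μ x * f x = 1)
    (hg : ∀ x, |g x| ≤ 1) (hg0 : ∑ x, μ x * g x = 0) :
    |∑ x, μ x * f x * g x| ≤ 2 * Real.sqrt (∑ x, μ x * f x * Real.log (f x)) := by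
  -- Passage through the Hellinger distance: `f - 1 = (s - 1)(s + 1)` and Cauchy-Schwarz, with `∑ μ
  -- (s + 1)² ≤ 4` giving the constant 2. The squared distance `∑ μ (s - 1)²` is below the entropy
  -- by `1 - 1/s ≤ log s`.
  set s : X → ℝ := fun x => Real.sqrt (f x) with hs
  have hs2 : ∀ x, s x ^ 2 = f x := fun x => Real.sq_sqrt (hf x).le
  have hspos : ∀ x, 0 < s x := fun x => Real.sqrt_pos.2 (hf x)
  have hsum2 : ∑ x, μ x * s x ^ 2 = 1 := by simpa only [hs2] using hf1
  have hA : ∑ x, μ x * (s x - 1) ^ 2 ≤ ∑ x, μ x * f x * Real.log (f x) := by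
    have h1 : ∑ x, μ x * (s x - 1) ^ 2 = ∑ x, μ x * (2 * (s x ^ 2 - s x)) := by
      have : ∑ x, μ x * (s x - 1) ^ 2
          = ∑ x, μ x * (2 * (s x ^ 2 - s x)) + (∑ x, μ x - ∑ x, μ x * s x ^ 2) := by
        rw [← Finset.sum_sub_distrib, ← Finset.sum_add_distrib]
        exact Finset.sum_congr rfl fun x _ => by ring
      rw [this, hsum2, hμ1, sub_self, add_zero]
    rw [h1]
    refine Finset.sum_le_sum fun x _ => ?_
    rw [mul_assoc]
    refine mul_le_mul_of_nonneg_left ?_ (hμ x).le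
    have h2 : Real.log (f x) = 2 * Real.log (s x) := by
      rw [← hs2, Real.log_pow]
      norm_num
    have h3 := Real.one_sub_inv_le_log_of_pos (hspos x)
    rw [h2, ← hs2]
    have h4 := mul_le_mul_of_nonneg_left h3 (sq_nonneg (s x))
    have h5 : s x ^ 2 * (1 - (s x)⁻¹) = s x ^ 2 - s x := by
      have := (hspos x).ne'
      field_simp
    linarith
  have hB : ∑ x, μ x * (s x + 1) ^ 2 ≤ 4 := by
    have : ∑ x, μ x * (s x + 1) ^ 2 + ∑ x, μ x * (s x - 1) ^ 2
        = 2 * ∑ x, μ x * s x ^ 2 + 2 * ∑ x, μ x := by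
      rw [Finset.mul_sum, Finset.mul_sum, ← Finset.sum_add_distrib, ← Finset.sum_add_distrib]
      exact Finset.sum_congr rfl fun x _ => by ring
    rw [hsum2, hμ1] at this
    have h0 : 0 ≤ ∑ x, μ x * (s x - 1) ^ 2 :=
      Finset.sum_nonneg fun x _ => mul_nonneg (hμ x).le (sq_nonneg _)
    linarith
  have hC : |∑ x, μ x * f x * g x| ≤ ∑ x, μ x * (|s x - 1| * (s x + 1)) := by
    have h1 : ∑ x, μ x * f x * g x = ∑ x, μ x * ((f x - 1) * g x) := by
      have : ∑ x, μ x * ((f x - 1) * g x) = ∑ x, μ x * f x * g x - ∑ x, μ x * g x := by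
        rw [← Finset.sum_sub_distrib]
        exact Finset.sum_congr rfl fun x _ => by ring
      rw [this, hg0, sub_zero]
    rw [h1]
    refine (Finset.abs_sum_le_sum_abs _ _).trans (Finset.sum_le_sum fun x _ => ?_)
    rw [abs_mul, abs_of_pos (hμ x), abs_mul]
    refine mul_le_mul_of_nonneg_left ?_ (hμ x).le
    have h2 : f x - 1 = (s x - 1) * (s x + 1) := by
      rw [← hs2]
      ring
    have h3 : |f x - 1| = |s x - 1| * (s x + 1) := by
      rw [h2, abs_mul, abs_of_pos (by have := hspos x; linarith : 0 < s x + 1)]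
    rw [h3]
    exact mul_le_of_le_one_right (mul_nonneg (abs_nonneg _) (by have := hspos x; linarith)) (hg x)
  have hD : (∑ x, μ x * (|s x - 1| * (s x + 1))) ^ 2
      ≤ (∑ x, μ x * (s x - 1) ^ 2) * ∑ x, μ x * (s x + 1) ^ 2 := by
    refine Finset.sum_sq_le_sum_mul_sum_of_sq_le_mul _
      (fun x _ => mul_nonneg (hμ x).le (sq_nonneg _))
      (fun x _ => mul_nonneg (hμ x).le (sq_nonneg _)) (fun x _ => le_of_eq ?_)
    rw [mul_pow, mul_pow, sq_abs]
    ring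
  have hE : (∑ x, μ x * (|s x - 1| * (s x + 1))) ^ 2
      ≤ 2 ^ 2 * ∑ x, μ x * f x * Real.log (f x) := by
    have h0 : 0 ≤ ∑ x, μ x * (s x - 1) ^ 2 :=
      Finset.sum_nonneg fun x _ => mul_nonneg (hμ x).le (sq_nonneg _)
    nlinarith [mul_le_mul_of_nonneg_left hB h0]
  have hF := Real.abs_le_sqrt hE
  rw [Real.sqrt_mul (by positivity), Real.sqrt_sq (by positivity)] at hF
  exact hC.trans ((le_abs_self _).trans hF)

omit hconn in
/-- Exponential decay of observables of mean zero under a classical modified logarithmic Sobolev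
inequality. -/
theorem abs_flipFlow_le_of_mlsi {α b : ℝ}
    (hmlsi : ∀ f : X → ℝ, (∀ x, 0 < f x) → ∑ x, μ x * f x = 1 →
      2 * α * ∑ x, μ x * f x * Real.log (f x)
        ≤ -∑ x, μ x * flipGenerator flip r f x * Real.log (f x))
    (hb : ∀ x, -Real.log (μ x) ≤ b) {g : X → ℝ} (hg : ∀ x, |g x| ≤ 1)
    (hg0 : ∑ x, μ x * g x = 0) {t : ℝ} (ht : 0 ≤ t) (x : X) :
    |flipFlow flip r t g x| ≤ 4 * Real.sqrt b * Real.exp (-α * t) := by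
  classical
  -- The equal mixture of the point mass at `x` and `μ`, as a density. The admixture of `μ` makes it
  -- strictly positive; since `g` has mean zero, it only costs a factor 2, which with the 2 of
  -- `abs_sum_le_sqrt_entropy` makes 4.
  set f : X → ℝ := fun y => (1 / 2) * (if y = x then (μ x)⁻¹ else 0) + 1 / 2 with hfdef
  have hf : ∀ y, 0 < f y := by
    intro y
    have := inv_pos.2 (hμ x)
    simp only [hfdef]
    split_ifs <;> positivity
  have hsum : ∀ h : X → ℝ, ∑ y, μ y * f y * h y = 1 / 2 * h x + 1 / 2 * ∑ y, μ y * h y := by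
    intro h
    have h1 : ∀ y, μ y * f y * h y
        = (if y = x then 1 / 2 * h x else 0) + 1 / 2 * (μ y * h y) := by
      intro y
      simp only [hfdef]
      split_ifs with hy
      · subst hy
        have := (hμ y).ne'
        field_simp
      · ring
    rw [Finset.sum_congr rfl fun y _ => h1 y, Finset.sum_add_distrib, ← Finset.mul_sum]
    simp
  have hf1 : ∑ y, μ y * f y = 1 := by
    have := hsum (fun _ => 1)
    simp only [mul_one, hμ1] at this
    rw [this]
    norm_num
  have hent : ∑ y, μ y * f y * Real.log (f y) ≤ b := by
    calc ∑ y, μ y * f y * Real.log (f y) ≤ ∑ y, μ y * f y * b := by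
          refine Finset.sum_le_sum fun y _ =>
            mul_le_mul_of_nonneg_left ?_ (mul_pos (hμ y) (hf y)).le
          refine le_trans ?_ (hb y)
          rw [← Real.log_inv]
          refine Real.log_le_log (hf y) ?_
          -- A single term of the normalized sum is at most one, so `f y ≤ 1 / μ y`.
          rw [le_inv_comm₀ (hf y) (hμ y), ← one_div, le_div_iff₀ (hf y), ← hf1]
          exact Finset.single_le_sum (f := fun y => μ y * f y)
            (fun y _ => (mul_pos (hμ y) (hf y)).le) (Finset.mem_univ y)
      _ = b := by rw [← Finset.sum_mul, hf1, one_mul]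
  have hr0 : ∀ v x, 0 ≤ r v x := fun v x => (hr v x).le
  have h1 := entropy_flipFlow_le hflip hrev hr hmlsi hf hf1 ht
  have h2 := abs_sum_le_sqrt_entropy hμ hμ1 (flipFlow_pos (flip := flip) hr0 ht hf)
    (by rw [sum_flipFlow hflip hrev, hf1]) hg hg0
  have h3 : ∑ y, μ y * flipFlow flip r t f y * g y = 1 / 2 * flipFlow flip r t g x := by
    have h4 := sum_mul_flipFlow_comm (r := r) hflip hrev t g f
    rw [hsum, sum_flipFlow hflip hrev, hg0, mul_zero, add_zero] at h4
    rw [← h4]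
    exact Finset.sum_congr rfl fun y _ => by ring
  have h5 : Real.sqrt (∑ y, μ y * flipFlow flip r t f y * Real.log (flipFlow flip r t f y))
      ≤ Real.exp (-α * t) * Real.sqrt b := by
    have h6 : Real.exp (-(2 * α) * t) = Real.exp (-α * t) ^ 2 := by
      rw [← Real.exp_nat_mul]
      congr 1
      push_cast
      ring
    have h7 := Real.sqrt_le_sqrt (h1.trans (mul_le_mul_of_nonneg_left hent (Real.exp_pos _).le))
    rwa [h6, Real.sqrt_mul (by positivity), Real.sqrt_sq (Real.exp_pos _).le] at h7
  rw [h3, abs_mul, abs_of_pos (by norm_num : (0 : ℝ) < 1 / 2)] at h2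
  linarith

end Convergence
end CSSDavies

namespace CSSDavies

/-! ### Dissipators -/

section Dissipator

variable {n : Type*} [Fintype n]

theorem dissipator_apply (J A : Op n) : dissipator J A = J.conjTranspose * A * J
    - (1 / 2 : ℂ) • (J.conjTranspose * J * A + A * (J.conjTranspose * J)) := rfl

theorem dissipator_conjTranspose (J A : Op n) :
    dissipator J A.conjTranspose = (dissipator J A).conjTranspose := by
  simp only [dissipator_apply, Matrix.conjTranspose_sub, Matrix.conjTranspose_mul,
    Matrix.conjTranspose_smul, Matrix.conjTranspose_add, Matrix.conjTranspose_conjTranspose,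
    mul_assoc]
  simp [add_comm]

/-- A factor commuting with the jump and its adjoint passes through every term of the dissipator. -/
theorem dissipator_mul_left {J B : Op n} (h₁ : Commute B J) (h₂ : Commute B J.conjTranspose)
    (A : Op n) : dissipator J (B * A) = B * dissipator J A := by
  have h3 := h₂.mul_right h₁
  simp only [dissipator_apply, Matrix.mul_sub, Matrix.mul_smul, Matrix.mul_add]
  rw [← mul_assoc (J.conjTranspose), ← h₂.eq, ← mul_assoc (J.conjTranspose * J), ← h3.eq]
  simp only [mul_assoc]

theorem dissipator_mul_right {J B : Op n} (h₁ : Commute B J) (h₂ : Commute B J.conjTranspose)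
    (A : Op n) : dissipator J (A * B) = dissipator J A * B := by
  have h3 := h₂.mul_right h₁
  simp only [dissipator_apply, Matrix.sub_mul, Matrix.smul_mul, Matrix.add_mul]
  rw [mul_assoc A B, h3.eq, ← mul_assoc, mul_assoc _ B J, h₁.eq]
  simp only [mul_assoc]

/-- In the double sandwich `Jᴴ Kᴴ A K J` the phase of `K J` meets its conjugate and cancels. In the
remaining terms `JᴴJ` slides past `K` and `KᴴK` past `J`. -/
theorem dissipator_commute {J K : Op n} {c : ℂ} (hc : star c * c = 1) (hKJ : K * J = c • (J * K))
    (h₁ : Commute (J.conjTranspose * J) K) (h₂ : Commute (K.conjTranspose * K) J) :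
    Commute (dissipator J) (dissipator K) := by
  set M := J.conjTranspose * J with hM
  set N := K.conjTranspose * K with hN
  have hMs : M.conjTranspose = M := by simp [hM]
  have hNs : N.conjTranspose = N := by simp [hN]
  have h₁' : Commute M K.conjTranspose := by
    have := congrArg Matrix.conjTranspose h₁.eq
    simp only [Matrix.conjTranspose_mul, hMs] at this
    exact this.symm
  have h₂' : Commute N J.conjTranspose := by
    have := congrArg Matrix.conjTranspose h₂.eq
    simp only [Matrix.conjTranspose_mul, hNs] at this
    exact this.symm
  have hMN : Commute M N := h₁'.mul_right h₁
  have hKJ' : J.conjTranspose * K.conjTranspose = star c • (K.conjTranspose * J.conjTranspose) := by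
    have := congrArg Matrix.conjTranspose hKJ
    simpa only [Matrix.conjTranspose_mul, Matrix.conjTranspose_smul] using this
  have hsq : ∀ A, J.conjTranspose * (K.conjTranspose * A * K) * J
      = K.conjTranspose * (J.conjTranspose * A * J) * K := by
    intro A
    calc J.conjTranspose * (K.conjTranspose * A * K) * J
        = (J.conjTranspose * K.conjTranspose) * A * (K * J) := by simp only [mul_assoc]
      _ = K.conjTranspose * (J.conjTranspose * A * J) * K := by
          rw [hKJ, hKJ', Matrix.smul_mul, Matrix.smul_mul, Matrix.mul_smul, smul_smul, hc,
            one_smul]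
          simp only [mul_assoc]
  refine LinearMap.ext fun A => ?_
  simp only [Module.End.mul_apply, dissipator_apply, ← hM, ← hN]
  simp only [Matrix.mul_sub, Matrix.sub_mul, Matrix.mul_smul, Matrix.smul_mul, Matrix.mul_add,
    Matrix.add_mul, smul_sub, smul_add, hsq]
  have e1 : J.conjTranspose * (N * A) * J = N * (J.conjTranspose * A * J) := by
    rw [← mul_assoc, ← h₂'.eq]; simp only [mul_assoc]
  have e2 : J.conjTranspose * (A * N) * J = J.conjTranspose * A * J * N := by
    rw [mul_assoc (J.conjTranspose), mul_assoc A, h₂.eq]; simp only [mul_assoc]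
  have e3 : K.conjTranspose * (M * A) * K = M * (K.conjTranspose * A * K) := by
    rw [← mul_assoc, ← h₁'.eq]; simp only [mul_assoc]
  have e4 : K.conjTranspose * (A * M) * K = K.conjTranspose * A * K * M := by
    rw [mul_assoc (K.conjTranspose), mul_assoc A, h₁.eq]; simp only [mul_assoc]
  have e5 : M * (N * A) = N * (M * A) := by rw [← mul_assoc, hMN.eq, mul_assoc]
  have e6 : A * N * M = A * M * N := by rw [mul_assoc A N, mul_assoc A M, hMN.eq]
  have e7 : M * (A * N) = M * A * N := (mul_assoc _ _ _).symm
  have e8 : N * (A * M) = N * A * M := (mul_assoc _ _ _).symm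
  rw [e1, e2, e3, e4, e5, e6, e7, e8]
  abel

end Dissipator

/-! ### Commuting diagonal observables with spin flips -/

section FlipRep

variable {Q X n : Type*} [Fintype X] [Fintype n] [DecidableEq n]

/-- A representation of the real observables of a classical spin system by Hermitian operators,
together with unitary involutions that implement the spin flips. -/
structure FlipRep (flip : Q → X → X) (n : Type*) [Fintype n] [DecidableEq n] where
  obs : (X → ℝ) →ₐ[ℝ] Op n
  obs_conjTranspose : ∀ f, (obs f).conjTranspose = obs f
  trace_obs : ∀ f, (obs f).trace = ((∑ x, f x : ℝ) : ℂ)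
  flipOp : Q → Op n
  flipOp_conjTranspose : ∀ v, (flipOp v).conjTranspose = flipOp v
  flipOp_mul_self : ∀ v, flipOp v * flipOp v = 1
  flipOp_mul_obs : ∀ v f, flipOp v * obs f = obs (f ∘ flip v) * flipOp v

namespace FlipRep

variable {flip : Q → X → X} (R : FlipRep flip n)

/-- The trace is faithful: it sends the image of `f²` to `∑ f²`. -/
theorem obs_injective : Function.Injective R.obs := by
  refine (injective_iff_map_eq_zero _).2 fun f hf => ?_
  have h1 : R.obs (f * f) = 0 := by rw [map_mul, hf, mul_zero]
  have h2 := R.trace_obs (f * f)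
  rw [h1, Matrix.trace_zero] at h2
  have h3 : ∑ x, f x * f x = 0 := by exact_mod_cast h2.symm
  ext x
  exact mul_self_eq_zero.1 ((Finset.sum_eq_zero_iff_of_nonneg
    (fun x _ => mul_self_nonneg (f x))).1 h3 x (Finset.mem_univ x))

theorem spectrum_obs_subset (w : X → ℝ) : spectrum ℝ (R.obs w) ⊆ Set.range w := by
  intro a ha
  have h := AlgHom.spectrum_apply_subset R.obs w ha
  rw [Pi.spectrum_eq] at h
  obtain ⟨x, hx⟩ := Set.mem_iUnion.1 h
  refine ⟨x, ?_⟩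
  by_contra hne
  refine hx (isUnit_iff_ne_zero.2 ?_)
  exact sub_ne_zero.2 fun h : a = w x => hne h.symm

/-- Only the finitely many values of `w` matter, so `g` may be replaced by its Lagrange interpolant,
and algebra homomorphisms commute with polynomials. -/
theorem cfc_obs (g : ℝ → ℝ) (w : X → ℝ) : cfc g (R.obs w) = R.obs (g ∘ w) := by
  classical
  set p := Lagrange.interpolate (Finset.univ.image w) id g with hp
  have hpe : ∀ x, p.eval (w x) = g (w x) := fun x =>
    Lagrange.eval_interpolate_at_node g (Set.injOn_id _)
      (Finset.mem_image_of_mem w (Finset.mem_univ x))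
  have h1 : cfc g (R.obs w) = cfc (fun x => p.eval x) (R.obs w) := by
    refine cfc_congr fun a ha => ?_
    obtain ⟨x, rfl⟩ := R.spectrum_obs_subset w ha
    exact (hpe x).symm
  rw [h1, cfc_polynomial p (R.obs w) (show IsSelfAdjoint _ from R.obs_conjTranspose w), Polynomial.aeval_algHom_apply]
  congr 1
  ext x
  have := Polynomial.aeval_algHom_apply (Pi.evalAlgHom ℝ (fun _ : X => ℝ) x) w p
  simp only [Pi.evalAlgHom_apply] at this
  rw [← this, Polynomial.coe_aeval_eq_eval, hpe]
  rfl

theorem mem_eigenvals (w : X → ℝ) (x : X) : w x ∈ eigenvals (R.obs w) := by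
  classical
  rw [eigenvals, Set.Finite.mem_toFinset, spectrum.mem_iff]
  intro h
  have h1 : algebraMap ℝ (Op n) (w x) - R.obs w = R.obs (algebraMap ℝ _ (w x) - w) := by
    rw [map_sub, AlgHom.commutes]
  rw [h1] at h
  -- The indicator of `x` is an eigenvector: it is annihilated by `w x - w` but is not zero.
  have h2 : R.obs (algebraMap ℝ _ (w x) - w) * R.obs (Pi.single x 1) = 0 := by
    rw [← map_mul]
    convert map_zero R.obs
    ext y
    by_cases hy : y = x
    · subst hy
      simp
    · simp [hy]
  have h3 : R.obs (Pi.single x 1) = R.obs 0 := by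
    rw [map_zero]
    exact (h.mul_right_eq_zero).1 h2
  have h4 := congrFun (R.obs_injective h3) x
  simp at h4

theorem spectralProj_obs (w : X → ℝ) (ω : ℝ) :
    spectralProj (R.obs w) ω = R.obs (fun x => if w x = ω then 1 else 0) :=
  R.cfc_obs _ w

theorem opLog_obs (f : X → ℝ) : opLog (R.obs f) = R.obs (Real.log ∘ f) :=
  R.cfc_obs _ f

open scoped ComplexOrder in
theorem posDef_obs {f : X → ℝ} (hf : ∀ x, 0 < f x) : (R.obs f).PosDef := by
  have h1 : R.obs f = (R.obs (Real.sqrt ∘ f)).conjTranspose * R.obs (Real.sqrt ∘ f) := by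
    rw [R.obs_conjTranspose, ← map_mul]
    congr 1
    ext x
    exact (Real.mul_self_sqrt (hf x).le).symm
  rw [h1]
  refine Matrix.PosDef.conjTranspose_mul_self _ (Matrix.mulVec_injective_of_isUnit ?_)
  have h2 : R.obs (Real.sqrt ∘ f) * R.obs (fun x => (Real.sqrt (f x))⁻¹) = 1 := by
    rw [← map_mul, ← map_one R.obs]
    congr 1
    ext x
    exact mul_inv_cancel₀ (Real.sqrt_pos.2 (hf x)).ne'
  exact IsUnit.of_mul_eq_one _ h2

theorem trace_obs_mul (f g : X → ℝ) :
    (R.obs f * R.obs g).trace = ((∑ x, f x * g x : ℝ) : ℂ) := by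
  rw [← map_mul, R.trace_obs]
  rfl

include R in
theorem flip_involutive (v : Q) : Function.Involutive (flip v) := by
  have h : ∀ f : X → ℝ, f ∘ flip v ∘ flip v = f := by
    intro f
    refine R.obs_injective ?_
    have h1 : R.obs (f ∘ flip v ∘ flip v) * (R.flipOp v * R.flipOp v)
        = (R.flipOp v * R.flipOp v) * R.obs f := by
      rw [← mul_assoc, mul_assoc (R.flipOp v), R.flipOp_mul_obs, ← mul_assoc, R.flipOp_mul_obs]
      rfl
    simpa only [R.flipOp_mul_self, mul_one, one_mul] using h1
  classical
  intro x
  have := congrFun (h (fun y => if y = x then 1 else 0)) x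
  by_contra hne
  simp [hne] at this

/-- At a given configuration exactly one spectral projection is nonzero, so the sum over Bohr
frequencies collapses to the rate at the local field. This produces the classical flip rates. -/
theorem sum_eigenvals_obs (w : Q → X → ℝ) (h : Q → ℝ → ℝ) (v : Q) (x : X) :
    ∑ ω ∈ eigenvals (R.obs (w v)), h v ω * (if w v x = ω then 1 else 0) = h v (w v x) := by
  simp [R.mem_eigenvals (w v) x]

theorem jump_conj (v : Q) (p f : X → ℝ) :
    (R.flipOp v * R.obs p).conjTranspose * R.obs f * (R.flipOp v * R.obs p)
      = R.obs (p * (f ∘ flip v) * p) := by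
  rw [Matrix.conjTranspose_mul, R.obs_conjTranspose, R.flipOp_conjTranspose,
    mul_assoc (R.obs p), R.flipOp_mul_obs, mul_assoc, mul_assoc (R.obs (f ∘ flip v)),
    ← mul_assoc (R.flipOp v), R.flipOp_mul_self, one_mul, map_mul, map_mul, mul_assoc]

theorem jump_conj_one (v : Q) (p : X → ℝ) :
    (R.flipOp v * R.obs p).conjTranspose * (R.flipOp v * R.obs p) = R.obs (p * p) := by
  have := R.jump_conj v p 1
  rw [map_one, mul_one] at this
  rw [this]
  congr 1
  ext x
  simp

theorem smul_obs (c : ℝ) (f : X → ℝ) : (c : ℂ) • R.obs f = R.obs (c • f) := by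
  rw [map_smul]
  ext i j
  simp

end FlipRep

variable [Fintype Q]

/-- The Lindbladian with jump operators `F v P_v(ω)`, where `P_v(ω)` are the spectral projections
of `A v`. -/
noncomputable def jumpLindbladian (F A : Q → Op n) (h : Q → ℝ → ℝ) : SuperOp n :=
  ∑ v, ∑ ω ∈ eigenvals (A v), (h v ω : ℂ) • dissipator (F v * spectralProj (A v) ω)

theorem jumpLindbladian_apply (F A : Q → Op n) (h : Q → ℝ → ℝ) (O : Op n) :
    jumpLindbladian F A h O
      = ∑ v, ∑ ω ∈ eigenvals (A v), (h v ω : ℂ) • dissipator (F v * spectralProj (A v) ω) O := by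
  simp [jumpLindbladian, LinearMap.sum_apply]

theorem jumpLindbladian_conjTranspose (F A : Q → Op n) (h : Q → ℝ → ℝ) (O : Op n) :
    jumpLindbladian F A h O.conjTranspose = (jumpLindbladian F A h O).conjTranspose := by
  simp [jumpLindbladian_apply, Matrix.conjTranspose_sum, dissipator_conjTranspose,
    Matrix.conjTranspose_smul]

namespace FlipRep

variable {flip : Q → X → X} (R : FlipRep flip n) (w : Q → X → ℝ) (h : Q → ℝ → ℝ)

theorem jumpLindbladian_obs (f : X → ℝ) :
    jumpLindbladian R.flipOp (fun v => R.obs (w v)) h (R.obs f)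
      = R.obs (flipGenerator flip (fun v x => h v (w v x)) f) := by
  have hd : ∀ v ω, dissipator (R.flipOp v * spectralProj (R.obs (w v)) ω) (R.obs f)
      = R.obs (fun x => (if w v x = ω then 1 else 0) * (f (flip v x) - f x)) := by
    intro v ω
    rw [R.spectralProj_obs, dissipator_apply, R.jump_conj, R.jump_conj_one, ← map_mul, ← map_mul,
      ← map_add]
    have h2 : (1 / 2 : ℂ) = ((1 / 2 : ℝ) : ℂ) := by norm_num
    rw [h2, R.smul_obs, ← map_sub]
    congr 1
    ext x
    simp only [Pi.sub_apply, Pi.mul_apply, Pi.add_apply, Pi.smul_apply, Function.comp_apply,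
      smul_eq_mul]
    split_ifs <;> ring
  rw [jumpLindbladian_apply]
  simp only [hd, R.smul_obs, ← map_sum]
  congr 1
  ext x
  rw [flipGenerator_apply, Finset.sum_apply]
  refine Finset.sum_congr rfl fun v _ => ?_
  rw [Finset.sum_apply, ← R.sum_eigenvals_obs w h v x, Finset.sum_mul]
  refine Finset.sum_congr rfl fun ω _ => ?_
  simp only [Pi.smul_apply, smul_eq_mul, mul_assoc]

/-- The adjoint gives the master equation for probabilities; by detailed balance, densities relative
to `μ` evolve under the same generator as observables. -/
theorem hsAdjoint_jumpLindbladian_obs {μ : X → ℝ}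
    (hrev : ∀ v x, μ (flip v x) * h v (w v (flip v x)) = μ x * h v (w v x)) (f : X → ℝ) :
    hsAdjoint (jumpLindbladian R.flipOp (fun v => R.obs (w v)) h) (R.obs (μ * f))
      = R.obs (μ * flipGenerator flip (fun v x => h v (w v x)) f) := by
  refine hsAdjoint_eq_of_trace fun B => ?_
  have hd : ∀ v ω, (R.obs (μ * f) *
        dissipator (R.flipOp v * spectralProj (R.obs (w v)) ω) B).trace
      = (R.obs (fun x => (if w v (flip v x) = ω then 1 else 0) * (μ * f) (flip v x)
          - (if w v x = ω then 1 else 0) * (μ * f) x) * B).trace := by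
    intro v ω
    set g := μ * f
    set p : X → ℝ := fun x => if w v x = ω then 1 else 0 with hp
    rw [R.spectralProj_obs, ← hp, dissipator_apply, R.jump_conj_one]
    have hpp : p * p = p := by
      ext x
      simp only [hp, Pi.mul_apply]
      split_ifs <;> ring
    rw [hpp, Matrix.mul_sub, Matrix.trace_sub, Matrix.mul_smul, Matrix.trace_smul, Matrix.mul_add,
      Matrix.trace_add]
    have e1 : (R.obs g * (R.obs p * B)).trace = (R.obs (p * g) * B).trace := by
      rw [← mul_assoc, ← map_mul, mul_comm g]
    have e2 : (R.obs g * (B * R.obs p)).trace = (R.obs (p * g) * B).trace := by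
      rw [← mul_assoc, Matrix.trace_mul_comm, ← mul_assoc, ← map_mul]
    have e3 : (R.obs g * ((R.flipOp v * R.obs p).conjTranspose * B * (R.flipOp v * R.obs p))).trace
        = (R.obs ((p * g) ∘ flip v) * B).trace := by
      rw [← mul_assoc, Matrix.trace_mul_comm, ← mul_assoc, ← mul_assoc, Matrix.conjTranspose_mul,
        R.obs_conjTranspose, R.flipOp_conjTranspose, ← mul_assoc]
      have : R.flipOp v * R.obs p * R.obs g * R.obs p * R.flipOp v = R.obs ((p * g) ∘ flip v) := by
        rw [mul_assoc (R.flipOp v), ← map_mul, mul_assoc (R.flipOp v), ← map_mul, R.flipOp_mul_obs,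
          mul_assoc, R.flipOp_mul_self, mul_one, mul_right_comm, hpp]
      rw [this]
    have e4 : R.obs (fun x => (if w v (flip v x) = ω then 1 else 0) * g (flip v x)
        - (if w v x = ω then 1 else 0) * g x) = R.obs ((p * g) ∘ flip v) - R.obs (p * g) := by
      rw [← map_sub]
      rfl
    rw [e1, e2, e3, e4, Matrix.sub_mul, Matrix.trace_sub, smul_eq_mul]
    ring
  rw [R.obs_conjTranspose, R.obs_conjTranspose, jumpLindbladian_apply]
  simp only [Matrix.mul_sum, Matrix.trace_sum, Matrix.mul_smul, Matrix.trace_smul, hd]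
  simp only [← Matrix.trace_smul, ← Matrix.smul_mul, R.smul_obs, ← Matrix.trace_sum,
    ← Finset.sum_mul, ← map_sum]
  congr 3
  ext x
  rw [Pi.mul_apply, flipGenerator_apply, Finset.sum_apply, Finset.mul_sum]
  refine Finset.sum_congr rfl fun v _ => ?_
  rw [Finset.sum_apply]
  simp only [Pi.smul_apply, smul_eq_mul, mul_sub, Finset.sum_sub_distrib, ← mul_assoc,
    ← Finset.sum_mul, R.sum_eigenvals_obs w h, Pi.mul_apply]
  -- Detailed balance rewrites the gain from the flipped configuration as a rate at `x`.
  have := hrev v x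
  linear_combination (-f (flip v x)) * this

end FlipRep

end FlipRep
end CSSDavies

namespace CSSDavies

/-! ### Restriction of the evolution and of the MLSI to classical states -/

section ClassicalReduction

variable {Q X n : Type*} [Fintype Q] [Fintype X] [Fintype n] [DecidableEq n]

namespace FlipRep

variable {flip : Q → X → X} (R : FlipRep flip n) (w : Q → X → ℝ) (h : Q → ℝ → ℝ)

theorem semigroup_jumpLindbladian_obs (t : ℝ) (f : X → ℝ) :
    semigroup (jumpLindbladian R.flipOp (fun v => R.obs (w v)) h) t (R.obs f)
      = R.obs (flipFlow flip (fun v x => h v (w v x)) t f) :=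
  semigroup_apply_of_intertwine R.obs.toLinearMap (R.jumpLindbladian_obs w h) t f

variable {μ : X → ℝ} (hrev : ∀ v x, μ (flip v x) * h v (w v (flip v x)) = μ x * h v (w v x))
include hrev

theorem evolve_jumpLindbladian_obs (t : ℝ) (f : X → ℝ) :
    evolve (jumpLindbladian R.flipOp (fun v => R.obs (w v)) h) t (R.obs (μ * f))
      = R.obs (μ * flipFlow flip (fun v x => h v (w v x)) t f) :=
  semigroup_apply_of_intertwine (R.obs.toLinearMap ∘ₗ LinearMap.mulLeft ℝ μ)
    (R.hsAdjoint_jumpLindbladian_obs w h hrev) t f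

variable (hμ : ∀ x, 0 < μ x) (hh : ∀ v x, 0 < h v (w v x)) (hμ1 : ∑ x, μ x = 1)
  (hconn : ∀ f : X → ℝ, (∀ v x, f (flip v x) = f x) → ∀ x y, f x = f y)
include hμ hh hμ1 hconn

theorem longTimeLimit_jumpLindbladian_obs {f : X → ℝ} (hf : ∑ x, μ x * f x = 1) :
    longTimeLimit (jumpLindbladian R.flipOp (fun v => R.obs (w v)) h) (R.obs (μ * f))
      = R.obs μ := by
  -- `limUnder` is meaningful only if the limit exists; ergodicity of the classical chain supplies
  -- the convergence.
  refine Filter.Tendsto.limUnder_eq ?_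
  simp only [R.evolve_jumpLindbladian_obs w h hrev]
  have h1 : Filter.Tendsto (fun t => μ * flipFlow flip (fun v x => h v (w v x)) t f) Filter.atTop
      (nhds μ) := by
    refine tendsto_pi_nhds.2 fun x => ?_
    have := (tendsto_flipFlow R.flip_involutive hrev hμ hh hμ1 hconn f x).const_mul (μ x)
    rwa [hf, mul_one] at this
  exact (R.obs.toLinearMap.continuous_of_finiteDimensional.tendsto μ).comp h1

/-- The modified logarithmic Sobolev inequality restricts to the classical states. -/
theorem classical_mlsi {α : ℝ}
    (hM : ∀ σ, IsFullRankState σ →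
      2 * α * relEntropy σ
          (longTimeLimit (jumpLindbladian R.flipOp (fun v => R.obs (w v)) h) σ)
        ≤ entropyProduction (jumpLindbladian R.flipOp (fun v => R.obs (w v)) h) σ)
    (f : X → ℝ) (hf : ∀ x, 0 < f x) (hf1 : ∑ x, μ x * f x = 1) :
    2 * α * ∑ x, μ x * f x * Real.log (f x)
      ≤ -∑ x, μ x * flipGenerator flip (fun v x => h v (w v x)) f x * Real.log (f x) := by
  have hσ : IsFullRankState (R.obs (μ * f)) := by
    refine ⟨R.posDef_obs fun x => mul_pos (hμ x) (hf x), ?_⟩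
    rw [R.trace_obs]
    exact_mod_cast hf1
  have h1 := hM _ hσ
  -- The Gibbs factor cancels in the difference of logarithms, leaving the density relative to `μ`;
  -- both sides of the MLSI become classical sums.
  have hlog : opLog (R.obs (μ * f)) - opLog (R.obs μ) = R.obs (Real.log ∘ f) := by
    rw [R.opLog_obs, R.opLog_obs, ← map_sub]
    congr 1
    ext x
    simp [Real.log_mul (hμ x).ne' (hf x).ne']
  rw [relEntropy, entropyProduction,
    R.longTimeLimit_jumpLindbladian_obs w h hrev hμ hh hμ1 hconn hf1, hlog,
    R.hsAdjoint_jumpLindbladian_obs w h hrev, R.trace_obs_mul, R.trace_obs_mul,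
    Complex.ofReal_re, Complex.ofReal_re] at h1
  exact h1

end FlipRep

end ClassicalReduction

/-! ### Functional calculus by polynomials and trace bounds -/

section Bounds

variable {n : Type*} [Fintype n] [DecidableEq n]

/-- Keeps the functional calculus inside the algebra generated by `A`. This serves both commutation
with spectral projections and membership of the Gibbs weight in the star algebra. -/
theorem exists_aeval_eq_cfc {A : Op n} (hA : A.IsHermitian) (g : ℝ → ℝ) :
    ∃ p : Polynomial ℝ, cfc g A = Polynomial.aeval A p := by
  refine ⟨Lagrange.interpolate (eigenvals A) id g, ?_⟩
  rw [← cfc_polynomial _ A hA.isSelfAdjoint]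
  refine cfc_congr fun a ha => ?_
  refine (Lagrange.eval_interpolate_at_node (v := id) g (Set.injOn_id _) ?_).symm
  rwa [eigenvals, Set.Finite.mem_toFinset]

theorem commute_cfc {A B : Op n} (hA : A.IsHermitian) (h : Commute B A) (g : ℝ → ℝ) :
    Commute B (cfc g A) := by
  obtain ⟨p, hp⟩ := exists_aeval_eq_cfc hA g
  rw [hp]
  have h2 : Polynomial.aeval A p ∈ Algebra.adjoin ℝ {A} := Polynomial.aeval_mem_adjoin_singleton ℝ A
  have h3 : Algebra.adjoin ℝ {A} ≤ Subalgebra.centralizer ℝ {B} := by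
    refine Algebra.adjoin_le ?_
    rintro _ rfl
    refine (Subalgebra.mem_centralizer_iff ℝ).2 fun _ hb => ?_
    rw [Set.mem_singleton_iff.1 hb]
    exact h
  exact (Subalgebra.mem_centralizer_iff ℝ).1 (h3 h2) B rfl

open scoped Matrix.Norms.L2Operator in
theorem norm_entry_le (A : Op n) (i j : n) : ‖A i j‖ ≤ ‖A‖ := by
  have h := Matrix.l2_opNorm_mulVec A (EuclideanSpace.single j (1 : ℂ))
  rw [PiLp.norm_single, norm_one, mul_one] at h
  refine le_trans ?_ h
  have h2 := PiLp.norm_apply_le ((EuclideanSpace.equiv n ℂ).symm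
    (A.mulVec (EuclideanSpace.single j (1 : ℂ)).ofLp)) i
  refine le_trans (le_of_eq ?_) h2
  congr 1
  simp

open scoped Matrix.Norms.L2Operator ComplexOrder in
-- In an eigenbasis of the state the trace is a convex combination of diagonal entries of a unitary
-- conjugate of `A`.
theorem norm_trace_mul_le {σ : Op n} (hσ : IsState σ) (A : Op n) : ‖(σ * A).trace‖ ≤ ‖A‖ := by
  obtain ⟨hpos, htr⟩ := hσ
  set U := hpos.isHermitian.eigenvectorUnitary with hU
  set l := hpos.isHermitian.eigenvalues with hl
  have hspec : σ = (U : Op n) * Matrix.diagonal (fun i => (l i : ℂ)) * star (U : Op n) :=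
    hpos.isHermitian.spectral_theorem
  have hl0 : ∀ i, 0 ≤ l i := hpos.eigenvalues_nonneg
  have hl1 : ∑ i, l i = 1 := by
    have h : (1 : ℂ) = ∑ i, (l i : ℂ) :=
      htr.symm.trans hpos.isHermitian.trace_eq_sum_eigenvalues
    exact_mod_cast h.symm
  set B := star (U : Op n) * A * (U : Op n) with hB
  have hBn : ‖B‖ ≤ ‖A‖ := by
    rw [hB, CStarRing.norm_mul_coe_unitary]
    refine le_of_eq ?_
    rw [← Unitary.coe_star, CStarRing.norm_coe_unitary_mul]
  have h1 : (σ * A).trace = ∑ i, (l i : ℂ) * B i i := by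
    conv_lhs => rw [hspec]
    rw [mul_assoc, mul_assoc, Matrix.trace_mul_comm, mul_assoc, ← hB]
    simp [Matrix.trace, Matrix.diagonal_mul]
  rw [h1]
  calc ‖∑ i, (l i : ℂ) * B i i‖ ≤ ∑ i, l i * ‖A‖ := by
        refine (norm_sum_le _ _).trans (Finset.sum_le_sum fun i _ => ?_)
        rw [norm_mul, Complex.norm_real, Real.norm_of_nonneg (hl0 i)]
        exact mul_le_mul_of_nonneg_left ((norm_entry_le B i i).trans hBn) (hl0 i)
    _ = ‖A‖ := by rw [← Finset.sum_mul, hl1, one_mul]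

end Bounds
end CSSDavies

namespace CSSDavies

/-! ### Pauli strings -/

section Pauli

variable {Q : Type*} [Fintype Q] [DecidableEq Q]

theorem tensorOp_mul (M N : Q → Matrix (Fin 2) (Fin 2) ℂ) :
    tensorOp M * tensorOp N = tensorOp fun v => M v * N v := by
  ext x y
  simp only [tensorOp, Matrix.mul_apply, Matrix.of_apply, ← Finset.prod_mul_distrib]
  rw [Finset.prod_univ_sum, Fintype.piFinset_univ]

omit [DecidableEq Q] in
theorem tensorOp_conjTranspose (M : Q → Matrix (Fin 2) (Fin 2) ℂ) :
    (tensorOp M).conjTranspose = tensorOp fun v => (M v).conjTranspose := by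
  ext x y
  simp [tensorOp]

omit [DecidableEq Q] in
theorem tensorOp_one : tensorOp (fun _ : Q => (1 : Matrix (Fin 2) (Fin 2) ℂ)) = 1 := by
  ext x y
  simp only [tensorOp, Matrix.of_apply]
  by_cases h : x = y
  · subst h
    simp
  · obtain ⟨v, hv⟩ := Function.ne_iff.1 h
    rw [Matrix.one_apply_ne h]
    exact Finset.prod_eq_zero (Finset.mem_univ v) (Matrix.one_apply_ne hv)

theorem pauliX_mul_self : pauliX * pauliX = 1 := by
  ext i j
  fin_cases i <;> fin_cases j <;> simp [pauliX, Matrix.mul_apply]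

theorem pauliString_empty (P : Matrix (Fin 2) (Fin 2) ℂ) :
    pauliString P (∅ : Finset Q) = 1 := by
  simp [pauliString, tensorOp_one]

theorem pauliString_mul {P : Matrix (Fin 2) (Fin 2) ℂ} (hP : P * P = 1) (a b : Finset Q) :
    pauliString P a * pauliString P b = pauliString P (symmDiff a b) := by
  rw [pauliString, pauliString, tensorOp_mul, pauliString]
  congr 1
  ext1 v
  by_cases ha : v ∈ a <;> by_cases hb : v ∈ b <;> simp [ha, hb, hP, Finset.mem_symmDiff]

theorem pauliString_conjTranspose {P : Matrix (Fin 2) (Fin 2) ℂ} (hP : P.conjTranspose = P)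
    (a : Finset Q) : (pauliString P a).conjTranspose = pauliString P a := by
  rw [pauliString, tensorOp_conjTranspose]
  congr 1
  ext1 v
  split_ifs <;> simp [hP]

theorem trace_pauliString_pauliX {a : Finset Q} (ha : a.Nonempty) :
    (pauliString pauliX a).trace = 0 := by
  obtain ⟨v, hv⟩ := ha
  refine Finset.sum_eq_zero fun x _ => ?_
  refine Finset.prod_eq_zero (Finset.mem_univ v) ?_
  have : ∀ i : Fin 2, pauliX i i = 0 := by
    intro i
    fin_cases i <;> simp [pauliX]
  simp [hv, this]

/-- Flip the bit at `v`. -/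
def flipBit (v : Q) (x : Config Q) : Config Q := x + Pi.single v 1

/-- The character `∏_{v ∈ a} (-1)^{x v}`. -/
def character (a : Finset Q) (x : Config Q) : ℝ := ∏ v ∈ a, if x v = 0 then 1 else -1

omit [Fintype Q] in
theorem character_flipBit (a : Finset Q) (v : Q) (x : Config Q) :
    character a (flipBit v x) = (if v ∈ a then -1 else 1) * character a x := by
  have h : ∀ u, (if flipBit v x u = 0 then (1 : ℝ) else -1)
      = (if u = v then -1 else 1) * (if x u = 0 then 1 else -1) := by
    intro u
    by_cases hu : u = v
    · subst hu
      have : ∀ i : Fin 2, (if i + 1 = 0 then (1 : ℝ) else -1) = -1 * (if i = 0 then 1 else -1) := by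
        intro i
        fin_cases i <;> simp
      simpa [flipBit] using this (x u)
    · simp [flipBit, hu]
  simp only [character, h, Finset.prod_mul_distrib, Finset.prod_ite_eq']

omit [Fintype Q] [DecidableEq Q] in
theorem abs_character (a : Finset Q) (x : Config Q) : |character a x| = 1 := by
  rw [character, Finset.abs_prod]
  refine Finset.prod_eq_one fun v _ => ?_
  split_ifs <;> simp

/-- Irreducibility of the chain: `x` is transformed into `y` by changing one bit at a time. -/
theorem eq_of_flipBit_invariant {f : Config Q → ℝ} (hf : ∀ v x, f (flipBit v x) = f x)
    (x y : Config Q) : f x = f y := by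
  have h : ∀ (s : Finset Q) (z : Config Q), f (z + ∑ v ∈ s, Pi.single v (y v - x v)) = f z := by
    intro s
    induction s using Finset.induction_on with
    | empty => simp
    | insert v s hv ih =>
      intro z
      rw [Finset.sum_insert hv, ← add_assoc, ih]
      generalize y v - x v = i
      fin_cases i
      · simp
      · exact hf v z
  have h1 := h Finset.univ x
  rw [Finset.univ_sum_single] at h1
  rw [← h1]
  congr 1
  ext v
  simp

theorem pauliString_pauliZ (a : Finset Q) :
    pauliString pauliZ a = Matrix.diagonal fun x => (character a x : ℂ) := by
  ext x y
  simp only [pauliString, tensorOp, Matrix.of_apply]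
  by_cases h : x = y
  · subst h
    have h1 : character a x = ∏ v, if v ∈ a then (if x v = 0 then (1 : ℝ) else -1) else 1 := by
      rw [Finset.prod_ite_mem, Finset.univ_inter, character]
    rw [Matrix.diagonal_apply_eq, h1, Complex.ofReal_prod]
    refine Finset.prod_congr rfl fun v _ => ?_
    split_ifs with ha hx
    · simp [pauliZ, hx]
    · simp [pauliZ, Fin.eq_one_of_ne_zero _ hx]
    · simp
  · obtain ⟨v, hv⟩ := Function.ne_iff.1 h
    rw [Matrix.diagonal_apply_ne _ h]
    refine Finset.prod_eq_zero (Finset.mem_univ v) ?_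
    split_ifs
    · revert hv
      generalize x v = i
      generalize y v = j
      fin_cases i <;> fin_cases j <;> simp [pauliZ]
    · exact Matrix.one_apply_ne hv

theorem pauliX_single_apply_ne_zero {v : Q} {x y : Config Q}
    (h : pauliString pauliX {v} x y ≠ 0) : y = flipBit v x := by
  have h1 := Finset.prod_ne_zero_iff.1 h
  ext u
  have h2 := h1 u (Finset.mem_univ u)
  by_cases hu : u = v
  · subst hu
    simp only [Finset.mem_singleton, if_true] at h2
    simp only [flipBit, Pi.add_apply, Pi.single_eq_same]
    revert h2
    generalize x u = i
    generalize y u = j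
    fin_cases i <;> fin_cases j <;> simp [pauliX]
  · simp only [Finset.mem_singleton, hu, if_false] at h2
    have h3 : x u = y u := by
      by_contra hne
      exact h2 (Matrix.one_apply_ne hne)
    simp [flipBit, hu, h3]

theorem pauliX_conjTranspose : pauliX.conjTranspose = pauliX := by
  ext i j
  fin_cases i <;> fin_cases j <;> simp [pauliX]

/-- The Hadamard matrix. -/
noncomputable def hadamard : Matrix (Fin 2) (Fin 2) ℂ :=
  ((Real.sqrt 2)⁻¹ : ℂ) • !![1, 1; 1, -1]

theorem hadamard_conjTranspose : hadamard.conjTranspose = hadamard := by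
  ext i j
  fin_cases i <;> fin_cases j <;> simp [hadamard]

theorem hadamard_scalar : ((Real.sqrt 2)⁻¹ : ℂ) * ((Real.sqrt 2)⁻¹ : ℂ) = 1 / 2 := by
  rw [← mul_inv, ← Complex.ofReal_mul, Real.mul_self_sqrt (by norm_num)]
  norm_num

theorem hadamard_mul_self : hadamard * hadamard = 1 := by
  rw [hadamard, Matrix.smul_mul, Matrix.mul_smul, smul_smul, hadamard_scalar]
  ext i j
  fin_cases i <;> fin_cases j <;> simp <;> norm_num

theorem hadamard_mul_pauliZ_mul : hadamard * pauliZ * hadamard = pauliX := by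
  rw [hadamard, Matrix.smul_mul, Matrix.smul_mul, Matrix.mul_smul, smul_smul, hadamard_scalar]
  ext i j
  fin_cases i <;> fin_cases j <;> simp [pauliZ, pauliX] <;> norm_num

theorem hadamard_mul_pauliX_mul : hadamard * pauliX * hadamard = pauliZ := by
  rw [hadamard, Matrix.smul_mul, Matrix.smul_mul, Matrix.mul_smul, smul_smul, hadamard_scalar]
  ext i j
  fin_cases i <;> fin_cases j <;> simp [pauliZ, pauliX] <;> norm_num

variable (Q) in
/-- The Hadamard transform on all qubits. -/
noncomputable def hadamardOp : Op (Config Q) := tensorOp fun _ => hadamard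

theorem hadamardOp_mul_self : hadamardOp Q * hadamardOp Q = 1 := by
  rw [hadamardOp, tensorOp_mul, hadamard_mul_self, tensorOp_one]

omit [DecidableEq Q] in
theorem hadamardOp_conjTranspose : (hadamardOp Q).conjTranspose = hadamardOp Q := by
  rw [hadamardOp, tensorOp_conjTranspose, hadamard_conjTranspose]

theorem hadamardOp_conj {P P' : Matrix (Fin 2) (Fin 2) ℂ} (h : hadamard * P * hadamard = P')
    (a : Finset Q) : hadamardOp Q * pauliString P a * hadamardOp Q = pauliString P' a := by
  rw [hadamardOp, pauliString, tensorOp_mul, tensorOp_mul, pauliString]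
  congr 1
  ext1 v
  split_ifs
  · exact h
  · rw [mul_one, hadamard_mul_self]

/-- Conjugation of a representation by a Hermitian unitary. -/
noncomputable def FlipRep.conj {Q X n : Type*} [Fintype X] [Fintype n] [DecidableEq n] {flip : Q → X → X}
    (R : FlipRep flip n) (W : Op n) (hW : W.conjTranspose = W) (hWW : W * W = 1) :
    FlipRep flip n where
  obs := AlgHom.ofLinearMap
    ((LinearMap.mulLeft ℝ W ∘ₗ LinearMap.mulRight ℝ W) ∘ₗ R.obs.toLinearMap)
    (by simp [hWW])
    (fun f g => by
      change W * (R.obs (f * g) * W) = W * (R.obs f * W) * (W * (R.obs g * W))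
      have h : W * (W * (R.obs g * W)) = R.obs g * W := by rw [← mul_assoc W W, hWW, one_mul]
      rw [map_mul, mul_assoc W, mul_assoc (R.obs f) W, h, mul_assoc (R.obs f)])
  obs_conjTranspose f := by
    change (W * (R.obs f * W)).conjTranspose = W * (R.obs f * W)
    rw [Matrix.conjTranspose_mul, Matrix.conjTranspose_mul, hW, R.obs_conjTranspose, mul_assoc]
  trace_obs f := by
    change (W * (R.obs f * W)).trace = _
    rw [Matrix.trace_mul_comm, mul_assoc, hWW, mul_one, R.trace_obs]
  flipOp v := W * R.flipOp v * W
  flipOp_conjTranspose v := by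
    rw [Matrix.conjTranspose_mul, Matrix.conjTranspose_mul, hW, R.flipOp_conjTranspose, mul_assoc]
  flipOp_mul_self v := by
    rw [mul_assoc (W * R.flipOp v), mul_assoc W _ W, ← mul_assoc W W, hWW, one_mul,
      mul_assoc W, ← mul_assoc _ _ W, R.flipOp_mul_self, one_mul, hWW]
  flipOp_mul_obs v f := by
    change W * R.flipOp v * W * (W * (R.obs f * W))
      = W * (R.obs (f ∘ flip v) * W) * (W * R.flipOp v * W)
    rw [mul_assoc (W * R.flipOp v), ← mul_assoc W W, hWW, one_mul, mul_assoc W,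
      ← mul_assoc (R.flipOp v), R.flipOp_mul_obs]
    simp only [mul_assoc]
    rw [← mul_assoc W W, hWW, one_mul]

/-- Observables of the computational basis, flipped by Pauli `X`-operators. -/
noncomputable def zRep : FlipRep (flipBit (Q := Q)) (Config Q) where
  obs := (Matrix.diagonalAlgHom ℝ).comp
    (AlgHom.pi fun x => (Algebra.ofId ℝ ℂ).comp (Pi.evalAlgHom ℝ (fun _ : Config Q => ℝ) x))
  obs_conjTranspose f := by
    change (Matrix.diagonal fun x => (f x : ℂ)).conjTranspose = Matrix.diagonal fun x => (f x : ℂ)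
    rw [Matrix.diagonal_conjTranspose]
    congr 1
    ext x
    simp
  trace_obs f := by
    change (Matrix.diagonal fun x => (f x : ℂ)).trace = _
    simp
  flipOp v := pauliString pauliX {v}
  flipOp_conjTranspose v := pauliString_conjTranspose pauliX_conjTranspose _
  flipOp_mul_self v := by
    rw [pauliString_mul pauliX_mul_self, symmDiff_self]
    exact pauliString_empty _
  flipOp_mul_obs v f := by
    change pauliString pauliX {v} * Matrix.diagonal (fun x => (f x : ℂ))
      = Matrix.diagonal (fun x => (f (flipBit v x) : ℂ)) * pauliString pauliX {v}
    ext x y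
    rw [Matrix.mul_diagonal, Matrix.diagonal_mul]
    by_cases h : pauliString pauliX {v} x y = 0
    · simp [h]
    · rw [pauliX_single_apply_ne_zero h, mul_comm]

theorem zRep_obs (f : Config Q → ℝ) : zRep.obs f = Matrix.diagonal fun x => (f x : ℂ) := rfl

/-- Observables of the Hadamard-rotated basis, flipped by Pauli `Z`-operators. -/
noncomputable def xRep : FlipRep (flipBit (Q := Q)) (Config Q) :=
  zRep.conj (hadamardOp Q) hadamardOp_conjTranspose hadamardOp_mul_self

theorem xRep_obs (f : Config Q → ℝ) :
    xRep.obs f = hadamardOp Q * (zRep.obs f * hadamardOp Q) := rfl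

theorem zRep_flipOp (v : Q) : zRep.flipOp v = pauliString pauliX {v} := rfl

theorem xRep_flipOp (v : Q) : xRep.flipOp v = pauliString pauliZ {v} :=
  hadamardOp_conj hadamard_mul_pauliX_mul _

theorem zRep_character (a : Finset Q) : zRep.obs (character a) = pauliString pauliZ a :=
  (pauliString_pauliZ a).symm

theorem xRep_character (a : Finset Q) : xRep.obs (character a) = pauliString pauliX a := by
  rw [xRep_obs, zRep_character, ← mul_assoc, hadamardOp_conj hadamard_mul_pauliZ_mul]

open scoped Matrix.Norms.L2Operator

theorem norm_zRep_obs_le {f : Config Q → ℝ} {M : ℝ} (hM : 0 ≤ M) (hf : ∀ x, |f x| ≤ M) :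
    ‖zRep.obs f‖ ≤ M := by
  rw [zRep_obs, Matrix.l2_opNorm_diagonal]
  refine (pi_norm_le_iff_of_nonneg hM).2 fun x => ?_
  rw [Complex.norm_real]
  exact hf x

theorem norm_xRep_obs_le {f : Config Q → ℝ} {M : ℝ} (hM : 0 ≤ M) (hf : ∀ x, |f x| ≤ M) :
    ‖xRep.obs f‖ ≤ M := by
  have hu : hadamardOp Q ∈ unitary (Op (Config Q)) := by
    rw [Unitary.mem_iff, Matrix.star_eq_conjTranspose, hadamardOp_conjTranspose]
    exact ⟨hadamardOp_mul_self, hadamardOp_mul_self⟩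
  rw [xRep_obs, CStarRing.norm_mem_unitary_mul _ hu, CStarRing.norm_mul_mem_unitary _ hu]
  exact norm_zRep_obs_le hM hf

end Pauli
end CSSDavies

namespace CSSDavies

/-! ### Davies generators of CSS codes -/

section Codes

variable {Q S P : Type*} [Fintype Q] [DecidableEq Q] [Fintype S] [Fintype P] {β : ℝ}

namespace CSSCode

variable (C : CSSCode Q S P)

/-- The classical field `-2 ∑_{s ∋ v} ∏_{u ∈ d s} x_u`. -/
def classicalField {T : Type*} [Fintype T] (d : T → Finset Q) (v : Q) (x : Config Q) : ℝ :=
  -2 * ∑ s with v ∈ d s, character (d s) x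

theorem obs_classicalField {n T : Type*} [Fintype n] [DecidableEq n] [Fintype T]
    (R : FlipRep (flipBit (Q := Q)) n) (d : T → Finset Q) (v : Q) :
    R.obs (classicalField d v) = (-2 : ℂ) • ∑ s with v ∈ d s, R.obs (character (d s)) := by
  have h : classicalField d v = (-2 : ℝ) • ∑ s with v ∈ d s, character (d s) := by
    ext x
    simp [classicalField]
  rw [h, ← R.smul_obs, map_sum]
  norm_num

omit [Fintype P] in
theorem starField_eq (v : Q) : C.starField v = xRep.obs (classicalField C.d v) := by
  simp only [obs_classicalField, xRep_character]
  rfl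

omit [Fintype S] in
theorem plaqField_eq (v : Q) : C.plaqField v = zRep.obs (classicalField C.bd v) := by
  simp only [obs_classicalField, zRep_character]
  rfl

omit [Fintype P] in
theorem starLindbladian_eq (h : JumpRates β C.starField) :
    C.starLindbladian h
      = jumpLindbladian xRep.flipOp (fun v => xRep.obs (classicalField C.d v)) h.rate := by
  have h1 : C.starLindbladian h
      = jumpLindbladian (fun v => pauliString pauliZ {v}) C.starField h.rate := rfl
  rw [h1]
  congr 1
  · ext1 v
    rw [xRep_flipOp]
  · ext1 v
    rw [starField_eq]

omit [Fintype S] in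
theorem plaqLindbladian_eq (h : JumpRates β C.plaqField) :
    C.plaqLindbladian h
      = jumpLindbladian zRep.flipOp (fun v => zRep.obs (classicalField C.bd v)) h.rate := by
  have h1 : C.plaqLindbladian h
      = jumpLindbladian (fun v => pauliString pauliX {v}) C.plaqField h.rate := rfl
  rw [h1]
  congr 1
  ext1 v
  rw [plaqField_eq]

omit [Fintype P] in
theorem starField_isHermitian (v : Q) : (C.starField v).IsHermitian := by
  rw [starField_eq]
  exact xRep.obs_conjTranspose _

omit [Fintype S] in
theorem plaqField_isHermitian (v : Q) : (C.plaqField v).IsHermitian := by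
  rw [plaqField_eq]
  exact zRep.obs_conjTranspose _

omit [Fintype P] in
theorem commute_starField {B : Op (Config Q)} (h : ∀ s, Commute B (C.starOp s)) (v : Q) :
    Commute B (C.starField v) :=
  (Commute.sum_right _ _ _ fun s _ => h s).smul_right _

omit [Fintype S] in
theorem commute_plaqField {B : Op (Config Q)} (h : ∀ p, Commute B (C.plaqOp p)) (v : Q) :
    Commute B (C.plaqField v) :=
  (Commute.sum_right _ _ _ fun s _ => h s).smul_right _

omit [Fintype P] in
theorem commute_spectralProj_starField {B : Op (Config Q)} (h : ∀ s, Commute B (C.starOp s))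
    (v : Q) (ω : ℝ) : Commute B (spectralProj (C.starField v) ω) :=
  commute_cfc (C.starField_isHermitian v) (C.commute_starField h v) _

omit [Fintype S] in
theorem commute_spectralProj_plaqField {B : Op (Config Q)} (h : ∀ p, Commute B (C.plaqOp p))
    (v : Q) (ω : ℝ) : Commute B (spectralProj (C.plaqField v) ω) :=
  commute_cfc (C.plaqField_isHermitian v) (C.commute_plaqField h v) _

theorem commute_pauliString_pauliX (a b : Finset Q) :
    Commute (pauliString pauliX a) (pauliString pauliX b) := by
  rw [← xRep_character, ← xRep_character]
  exact (Commute.all _ _).map xRep.obs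

theorem commute_pauliString_pauliZ (a b : Finset Q) :
    Commute (pauliString pauliZ a) (pauliString pauliZ b) := by
  rw [← zRep_character, ← zRep_character]
  exact (Commute.all _ _).map zRep.obs

end CSSCode

theorem spectralProj_conjTranspose {n : Type*} [Fintype n] [DecidableEq n] (A : Op n) (ω : ℝ) :
    (spectralProj A ω).conjTranspose = spectralProj A ω :=
  cfc_predicate (p := IsSelfAdjoint) _ A

section Jump

variable {n : Type*} [Fintype n] [DecidableEq n] {F A : Q → Op n} {h : Q → ℝ → ℝ} {B : Op n}
  (hF : ∀ v, (F v).conjTranspose = F v) (hBF : ∀ v, Commute B (F v))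
  (hBA : ∀ v ω, Commute B (spectralProj (A v) ω))
include hF hBF hBA

omit [DecidableEq Q] in
-- Since `F v` and the projections are Hermitian, `B` also commutes with the adjoint jumps and can
-- be pulled out of the evolution.
theorem semigroup_jumpLindbladian_mul_left (t : ℝ) (O : Op n) :
    semigroup (jumpLindbladian F A h) t (B * O) = B * semigroup (jumpLindbladian F A h) t O := by
  refine (semigroup_map (LinearMap.mulLeft ℂ B) (fun O => ?_) t O).symm
  simp only [LinearMap.mulLeft_apply, jumpLindbladian_apply, Finset.mul_sum, Matrix.mul_smul]
  refine Finset.sum_congr rfl fun v _ => Finset.sum_congr rfl fun ω _ => ?_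
  rw [dissipator_mul_left ((hBF v).mul_right (hBA v ω))]
  rw [Matrix.conjTranspose_mul, hF, spectralProj_conjTranspose]
  exact (hBA v ω).mul_right (hBF v)

omit [DecidableEq Q] in
theorem semigroup_jumpLindbladian_mul_right (t : ℝ) (O : Op n) :
    semigroup (jumpLindbladian F A h) t (O * B) = semigroup (jumpLindbladian F A h) t O * B := by
  refine (semigroup_map (LinearMap.mulRight ℂ B) (fun O => ?_) t O).symm
  simp only [LinearMap.mulRight_apply, jumpLindbladian_apply, Finset.sum_mul, Matrix.smul_mul]
  refine Finset.sum_congr rfl fun v _ => Finset.sum_congr rfl fun ω _ => ?_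
  rw [dissipator_mul_right ((hBF v).mul_right (hBA v ω))]
  rw [Matrix.conjTranspose_mul, hF, spectralProj_conjTranspose]
  exact (hBA v ω).mul_right (hBF v)

end Jump

/-- The sign is that of the character of `{v}` under a flip at `w`. It is the only obstruction to
commuting star and plaquette jumps. -/
theorem pauliX_mul_pauliZ_single (v w : Q) :
    pauliString pauliX {w} * pauliString pauliZ {v}
      = (if w = v then -1 else 1 : ℂ) • (pauliString pauliZ {v} * pauliString pauliX {w}) := by
  rw [← zRep_character, ← zRep_flipOp, zRep.flipOp_mul_obs]
  have h : character {v} ∘ flipBit w = (if w = v then -1 else 1 : ℝ) • character {v} := by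
    ext x
    simp [character_flipBit]
  rw [h, ← zRep.smul_obs, Matrix.smul_mul]
  split_ifs <;> simp

theorem pauliZ_conjTranspose : pauliZ.conjTranspose = pauliZ := by
  ext i j
  fin_cases i <;> fin_cases j <;> simp [pauliZ]

theorem pauliZ_mul_self : pauliZ * pauliZ = 1 := by
  ext i j
  fin_cases i <;> fin_cases j <;> simp [pauliZ, Matrix.mul_apply]

namespace CSSCode

variable (C : CSSCode Q S P) (hs : JumpRates β C.starField) (hp : JumpRates β C.plaqField)

/-- Star projections are functions of `X`-strings and commute with `X_w`; plaquette projections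
likewise commute with `Z_v`; the two kinds commute by the CSS condition. Only the sign between `Z_v`
and `X_w` is left, and `dissipator_commute` absorbs it. -/
theorem commute_starLindbladian_plaqLindbladian :
    Commute (C.starLindbladian hs) (C.plaqLindbladian hp) := by
  refine Commute.sum_left _ _ _ fun v _ => Commute.sum_left _ _ _ fun ω _ =>
    Commute.sum_right _ _ _ fun w _ => Commute.sum_right _ _ _ fun ω' _ =>
      Commute.smul_left (Commute.smul_right ?_ _) _
  set P₁ := spectralProj (C.starField v) ω with hP₁
  set P₂ := spectralProj (C.plaqField w) ω' with hP₂
  have h1 : Commute P₁ (pauliString pauliX {w}) :=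
    (C.commute_spectralProj_starField (fun s => commute_pauliString_pauliX _ _) v ω).symm
  have h2 : Commute P₂ (pauliString pauliZ {v}) :=
    (C.commute_spectralProj_plaqField (fun s => commute_pauliString_pauliZ _ _) w ω').symm
  have h3 : Commute P₁ P₂ := by
    refine C.commute_spectralProj_plaqField (fun p => ?_) w ω'
    exact (C.commute_spectralProj_starField (fun s => (C.comm s p).symm) v ω).symm
  have hJJ : (pauliString pauliZ {v} * P₁).conjTranspose * (pauliString pauliZ {v} * P₁)
      = P₁ * P₁ := by
    rw [Matrix.conjTranspose_mul, pauliString_conjTranspose pauliZ_conjTranspose,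
      spectralProj_conjTranspose, mul_assoc, ← mul_assoc (pauliString pauliZ {v}),
      pauliString_mul pauliZ_mul_self, symmDiff_self]
    erw [pauliString_empty]
    rw [one_mul]
  have hKK : (pauliString pauliX {w} * P₂).conjTranspose * (pauliString pauliX {w} * P₂)
      = P₂ * P₂ := by
    rw [Matrix.conjTranspose_mul, pauliString_conjTranspose pauliX_conjTranspose,
      spectralProj_conjTranspose, mul_assoc, ← mul_assoc (pauliString pauliX {w}),
      pauliString_mul pauliX_mul_self, symmDiff_self]
    erw [pauliString_empty]
    rw [one_mul]
  refine dissipator_commute (c := if w = v then -1 else 1) (by split_ifs <;> simp) ?_ ?_ ?_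
  · calc pauliString pauliX {w} * P₂ * (pauliString pauliZ {v} * P₁)
        = pauliString pauliX {w} * (P₂ * pauliString pauliZ {v}) * P₁ := by
          simp only [mul_assoc]
      _ = (pauliString pauliX {w} * pauliString pauliZ {v}) * (P₂ * P₁) := by
          rw [h2.eq]
          simp only [mul_assoc]
      _ = _ := by
          rw [pauliX_mul_pauliZ_single, Matrix.smul_mul, ← h3.eq]
          congr 1
          rw [mul_assoc, ← mul_assoc _ P₁, ← h1.eq]
          simp only [mul_assoc]
  · rw [hJJ]
    exact (h1.mul_right h3).mul_left (h1.mul_right h3)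
  · rw [hKK]
    exact (h2.mul_right h3.symm).mul_left (h2.mul_right h3.symm)

/-- The star part acts on products of `X`-strings and the plaquette part on products of
`Z`-strings. -/
theorem semigroup_daviesLindbladian_mul {a b : Finset Q}
    (ha : ∀ p, Commute (pauliString pauliX a) (C.plaqOp p))
    (hb : ∀ s, Commute (pauliString pauliZ b) (C.starOp s)) (t : ℝ) :
    semigroup (C.daviesLindbladian hs hp) t (pauliString pauliX a * pauliString pauliZ b)
      = xRep.obs (flipFlow flipBit (fun v x => hs.rate v (classicalField C.d v x)) t (character a))
        * zRep.obs (flipFlow flipBit (fun v x => hp.rate v (classicalField C.bd v x)) t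
            (character b)) := by
  set G := zRep.obs (flipFlow flipBit (fun v x => hp.rate v (classicalField C.bd v x)) t
            (character b)) with hG
  have hGZ : semigroup (C.plaqLindbladian hp) t (pauliString pauliZ b) = G := by
    rw [← zRep_character, plaqLindbladian_eq, zRep.semigroup_jumpLindbladian_obs]
  have hpl : C.plaqLindbladian hp
      = jumpLindbladian (fun v => pauliString pauliX {v}) C.plaqField hp.rate := rfl
  have hst : C.starLindbladian hs
      = jumpLindbladian (fun v => pauliString pauliZ {v}) C.starField hs.rate := rfl
  have hX : ∀ v : Q, (pauliString pauliX {v}).conjTranspose = pauliString pauliX {v} := fun v =>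
    pauliString_conjTranspose pauliX_conjTranspose _
  have hZ : ∀ v : Q, (pauliString pauliZ {v}).conjTranspose = pauliString pauliZ {v} := fun v =>
    pauliString_conjTranspose pauliZ_conjTranspose _
  -- A star commutes with every plaquette jump, so left and right multiplication by it both pass
  -- through the evolution; commutation with the `Z`-string at time zero therefore persists.
  have hGs : ∀ s, Commute G (C.starOp s) := by
    intro s
    have e1 := semigroup_jumpLindbladian_mul_left (A := C.plaqField) (h := hp.rate) hX
      (fun v => commute_pauliString_pauliX (C.d s) {v})
      (C.commute_spectralProj_plaqField fun p => C.comm s p) t (pauliString pauliZ b)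
    have e2 := semigroup_jumpLindbladian_mul_right (A := C.plaqField) (h := hp.rate) hX
      (fun v => commute_pauliString_pauliX (C.d s) {v})
      (C.commute_spectralProj_plaqField fun p => C.comm s p) t (pauliString pauliZ b)
    rw [← hpl, hGZ] at e1 e2
    have e3 := (hb s).eq
    rw [starOp] at e3
    rw [e3, e1] at e2
    exact e2.symm
  have hGZc : ∀ v, Commute G (pauliString pauliZ {v}) := by
    intro v
    rw [hG, ← zRep_character]
    exact (Commute.all _ _).map zRep.obs
  rw [daviesLindbladian, semigroup_add_of_commute (C.commute_starLindbladian_plaqLindbladian hs hp),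
    hpl, semigroup_jumpLindbladian_mul_left hX (fun v => commute_pauliString_pauliX a {v})
      (C.commute_spectralProj_plaqField ha), ← hpl, hGZ, hst,
    semigroup_jumpLindbladian_mul_right hZ hGZc (C.commute_spectralProj_starField hGs), ← hst,
    ← xRep_character, starLindbladian_eq, xRep.semigroup_jumpLindbladian_obs]

theorem daviesLindbladian_conjTranspose (O : Op (Config Q)) :
    C.daviesLindbladian hs hp O.conjTranspose
      = (C.daviesLindbladian hs hp O).conjTranspose := by
  rw [daviesLindbladian, starLindbladian_eq, plaqLindbladian_eq, LinearMap.add_apply,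
    LinearMap.add_apply, jumpLindbladian_conjTranspose, jumpLindbladian_conjTranspose,
    Matrix.conjTranspose_add]

/-! ### The Gibbs measure of the stars -/

/-- The Boltzmann weight of the stars. -/
noncomputable def starWeight (β : ℝ) (x : Config Q) : ℝ :=
  Real.exp (β * ∑ s, character (C.d s) x)

/-- The Gibbs measure of the stars. -/
noncomputable def starGibbs (β : ℝ) (x : Config Q) : ℝ :=
  C.starWeight β x / ∑ y, C.starWeight β y

omit [Fintype P] in
theorem starWeight_pos (x : Config Q) : 0 < C.starWeight β x := Real.exp_pos _

omit [Fintype P] in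
theorem sum_starWeight_pos : 0 < ∑ y, C.starWeight β y :=
  Finset.sum_pos (fun y _ => C.starWeight_pos y) Finset.univ_nonempty

omit [Fintype P] in
theorem starGibbs_pos (x : Config Q) : 0 < C.starGibbs β x :=
  div_pos (C.starWeight_pos x) C.sum_starWeight_pos

omit [Fintype P] in
theorem sum_starGibbs : ∑ x, C.starGibbs β x = 1 := by
  simp only [starGibbs]
  rw [← Finset.sum_div, div_self C.sum_starWeight_pos.ne']

omit [Fintype P] in
theorem classicalField_flipBit (v : Q) (x : Config Q) :
    classicalField C.d v (flipBit v x) = -classicalField C.d v x := by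
  have : ∑ s with v ∈ C.d s, character (C.d s) (flipBit v x)
      = -∑ s with v ∈ C.d s, character (C.d s) x := by
    rw [← Finset.sum_neg_distrib]
    refine Finset.sum_congr rfl fun s hs => ?_
    rw [character_flipBit, if_pos (Finset.mem_filter.1 hs).2, neg_one_mul]
  rw [classicalField, this, classicalField]
  ring

omit [Fintype P] in
-- Exactly the stars containing `v` change sign, so the exponent of the Gibbs weight changes by the
-- Bohr frequency.
theorem sum_character_flipBit (v : Q) (x : Config Q) :
    ∑ s, character (C.d s) (flipBit v x)
      = ∑ s, character (C.d s) x + classicalField C.d v x := by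
  rw [classicalField, Finset.sum_filter, Finset.mul_sum, ← Finset.sum_add_distrib]
  refine Finset.sum_congr rfl fun s _ => ?_
  rw [character_flipBit]
  split_ifs <;> ring

omit [Fintype P] in
theorem classicalField_mem_eigenvals (v : Q) (x : Config Q) :
    classicalField C.d v x ∈ eigenvals (C.starField v) := by
  rw [starField_eq]
  exact xRep.mem_eigenvals _ x

omit [Fintype P] in
theorem star_rate_pos (v : Q) (x : Config Q) : 0 < hs.rate v (classicalField C.d v x) :=
  hs.pos v _ (C.classicalField_mem_eigenvals v x)

omit [Fintype S] in
theorem plaq_rate_pos (v : Q) (x : Config Q) : 0 < hp.rate v (classicalField C.bd v x) := by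
  refine hp.pos v _ ?_
  rw [plaqField_eq]
  exact zRep.mem_eigenvals _ x

omit [Fintype P] in
-- With `ω` the local field at `x`, the flip multiplies the weight by `e^{βω}` and, as `ω` becomes
-- `-ω`, the rate by `e^{-βω}`.
theorem starGibbs_reversible (v : Q) (x : Config Q) :
    C.starGibbs β (flipBit v x) * hs.rate v (classicalField C.d v (flipBit v x))
      = C.starGibbs β x * hs.rate v (classicalField C.d v x) := by
  have h1 : C.starWeight β (flipBit v x)
      = C.starWeight β x * Real.exp (β * classicalField C.d v x) := by
    rw [starWeight, sum_character_flipBit, mul_add, Real.exp_add, starWeight]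
  rw [classicalField_flipBit, hs.detailed_balance v _ (C.classicalField_mem_eigenvals v x),
    starGibbs, h1, starGibbs]
  have h2 : Real.exp (β * classicalField C.d v x) * Real.exp (-β * classicalField C.d v x) = 1 := by
    rw [← Real.exp_add]
    simp
  linear_combination (C.starWeight β x / ∑ y, C.starWeight β y)
    * hs.rate v (classicalField C.d v x) * h2

omit [Fintype P] in
-- Each weight is at least `e^{-β|S|}`, and the partition function is at most `2^{|Q|} e^{β|S|}`.
-- This linear bound is the source of the polynomial prefactor.
theorem neg_log_starGibbs_le (hβ : 0 ≤ β) (x : Config Q) :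
    -Real.log (C.starGibbs β x)
      ≤ 2 * β * Fintype.card S + Fintype.card Q * Real.log 2 := by
  have hb : ∀ y, |∑ s, character (C.d s) y| ≤ Fintype.card S := by
    intro y
    refine (Finset.abs_sum_le_sum_abs _ _).trans (le_of_eq ?_)
    simp [abs_character]
  have h1 : Real.log (C.starWeight β x) ≥ -(β * Fintype.card S) := by
    rw [starWeight, Real.log_exp]
    have := mul_le_mul_of_nonneg_left (abs_le.1 (hb x)).1 hβ
    linarith
  have h2 : Real.log (∑ y, C.starWeight β y)
      ≤ Fintype.card Q * Real.log 2 + β * Fintype.card S := by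
    have h3 : ∑ y, C.starWeight β y ≤ 2 ^ Fintype.card Q * Real.exp (β * Fintype.card S) := by
      calc ∑ y, C.starWeight β y ≤ ∑ _y : Config Q, Real.exp (β * Fintype.card S) :=
            Finset.sum_le_sum fun y _ => Real.exp_le_exp.2
              (mul_le_mul_of_nonneg_left (abs_le.1 (hb y)).2 hβ)
        _ = _ := by simp
    refine (Real.log_le_log C.sum_starWeight_pos h3).trans (le_of_eq ?_)
    rw [Real.log_mul (by positivity) (Real.exp_pos _).ne', Real.log_pow, Real.log_exp]
  rw [starGibbs, Real.log_div (C.starWeight_pos x).ne' C.sum_starWeight_pos.ne']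
  linarith

omit [Fintype S] [Fintype P] in
theorem pauliString_of_mem_closure {M : Op (Config Q)}
    (hM : M ∈ Submonoid.closure (Set.range C.starOp)) : ∃ c, M = pauliString pauliX c := by
  induction hM using Submonoid.closure_induction with
  | mem x hx =>
    obtain ⟨s, rfl⟩ := hx
    exact ⟨C.d s, rfl⟩
  | one => exact ⟨∅, (pauliString_empty _).symm⟩
  | mul x y _ _ hx hy =>
    obtain ⟨c, rfl⟩ := hx
    obtain ⟨d, rfl⟩ := hy
    exact ⟨symmDiff c d, pauliString_mul pauliX_mul_self c d⟩

omit [Fintype S] [Fintype P] in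
-- The star algebra is spanned by products of stars, which are `X`-strings. Such a string times the
-- `X`-string on `a` is traceless unless the two coincide, and that would put the latter in the
-- stabilizer algebra.
theorem trace_mul_pauliX_eq_zero {a : Finset Q}
    (ha : pauliString pauliX a ∉ C.stabilizerAlgebra) {M : Op (Config Q)}
    (hM : M ∈ Algebra.adjoin ℂ (Set.range C.starOp)) : (M * pauliString pauliX a).trace = 0 := by
  have hle : Algebra.adjoin ℂ (Set.range C.starOp) ≤ C.stabilizerAlgebra :=
    Algebra.adjoin_mono Set.subset_union_left
  rw [← Subalgebra.mem_toSubmodule, Algebra.adjoin_eq_span] at hM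
  induction hM using Submodule.span_induction with
  | mem x hx =>
    obtain ⟨c, rfl⟩ := C.pauliString_of_mem_closure hx
    rw [pauliString_mul pauliX_mul_self]
    refine trace_pauliString_pauliX ?_
    rw [Finset.nonempty_iff_ne_empty]
    intro h
    have hca : c = a := symmDiff_eq_bot.1 h
    subst hca
    refine ha (hle ?_)
    rw [← Subalgebra.mem_toSubmodule, Algebra.adjoin_eq_span]
    exact Submodule.subset_span hx
  | zero => simp
  | add x y _ _ hx hy => rw [Matrix.add_mul, Matrix.trace_add, hx, hy, add_zero]
  | smul c x _ hx => rw [Matrix.smul_mul, Matrix.trace_smul, hx, smul_zero]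

omit [Fintype P] in
/-- Logical `X`-operators have vanishing thermal expectation. -/
theorem sum_starGibbs_mul_character {a : Finset Q}
    (ha : pauliString pauliX a ∉ C.stabilizerAlgebra) :
    ∑ x, C.starGibbs β x * character a x = 0 := by
  set H : Config Q → ℝ := ∑ s, character (C.d s) with hH
  have hHmem : xRep.obs H ∈ Algebra.adjoin ℂ (Set.range C.starOp) := by
    rw [hH, map_sum]
    refine Subalgebra.sum_mem _ fun s _ => ?_
    rw [xRep_character]
    exact Algebra.subset_adjoin ⟨s, rfl⟩
  -- The Gibbs weight is a function of `∑ A_s`, hence a polynomial in it.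
  have hw : xRep.obs (C.starWeight β) ∈ Algebra.adjoin ℂ (Set.range C.starOp) := by
    have h1 : xRep.obs (C.starWeight β) = cfc (fun y => Real.exp (β * y)) (xRep.obs H) := by
      rw [xRep.cfc_obs]
      congr 1
      ext x
      simp [starWeight, hH]
    obtain ⟨p, hp⟩ := exists_aeval_eq_cfc (xRep.obs_conjTranspose H) (fun y => Real.exp (β * y))
    rw [h1, hp]
    exact (Algebra.adjoin_le (S := (Algebra.adjoin ℂ (Set.range C.starOp)).restrictScalars ℝ)
      (Set.singleton_subset_iff.2 hHmem)) (Polynomial.aeval_mem_adjoin_singleton ℝ _)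
  have h2 := C.trace_mul_pauliX_eq_zero ha hw
  rw [← xRep_character, xRep.trace_obs_mul] at h2
  have h3 : ∑ x, C.starWeight β x * character a x = 0 := by exact_mod_cast h2
  simp only [starGibbs, div_mul_eq_mul_div]
  rw [← Finset.sum_div, h3, zero_div]

open scoped Matrix.Norms.L2Operator in
/-- Decay of logical operators under the Davies evolution. -/
theorem norm_trace_evolve_le {α : ℝ} (hβ : 0 ≤ β)
    (hM : ∀ σ, IsFullRankState σ →
      2 * α * relEntropy σ (longTimeLimit (C.starLindbladian hs) σ)
        ≤ entropyProduction (C.starLindbladian hs) σ)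
    {a b : Finset Q} (ha : C.IsLogicalX (pauliString pauliX a))
    (hb : ∀ s, Commute (pauliString pauliZ b) (C.starOp s))
    {σ : Op (Config Q)} (hσ : IsState σ) {t : ℝ} (ht : 0 ≤ t) :
    ‖(evolve (C.daviesLindbladian hs hp) t σ
        * (pauliString pauliX a * pauliString pauliZ b)).trace‖
      ≤ 4 * Real.sqrt (2 * β * Fintype.card S + Fintype.card Q * Real.log 2)
        * Real.exp (-α * t) := by
  rw [trace_evolve_mul (C.daviesLindbladian_conjTranspose hs hp),
    C.semigroup_daviesLindbladian_mul hs hp ha.1.2.1 hb]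
  refine (norm_trace_mul_le hσ _).trans ((norm_mul_le _ _).trans ?_)
  rw [starLindbladian_eq] at hM
  have h1 := xRep.classical_mlsi (classicalField C.d) hs.rate (C.starGibbs_reversible hs)
    C.starGibbs_pos (C.star_rate_pos hs) C.sum_starGibbs
    (fun f hf => eq_of_flipBit_invariant hf) hM
  have h2 := abs_flipFlow_le_of_mlsi xRep.flip_involutive (C.starGibbs_reversible hs)
    C.starGibbs_pos (C.star_rate_pos hs) C.sum_starGibbs h1 (C.neg_log_starGibbs_le hβ)
    (fun x => (abs_character a x).le) (C.sum_starGibbs_mul_character ha.1.2.2) ht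
  -- The `Z` factor needs no MLSI: contraction alone suffices, and all decay comes from the `X`
  -- factor.
  have h3 := abs_flipFlow_le (flip := flipBit) (fun v x => (C.plaq_rate_pos hp v x).le) ht
    (fun x => (abs_character b x).le)
  have h4 := norm_xRep_obs_le (by positivity) h2
  have h5 := norm_zRep_obs_le zero_le_one h3
  calc _ ≤ _ := mul_le_mul h4 h5 (norm_nonneg _) (by positivity)
    _ = _ := mul_one _

end CSSCode

end Codes
end CSSDavies

/-! ### Bounds in terms of the lattice size -/

namespace CSSDavies

namespace LatticeCSSCode

variable {D q nS nP : ℕ} (C : LatticeCSSCode D q nS nP)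

/-- Without qubits the only `X`-string is the identity, which is never logical. -/
theorem one_le_size_of_isLogical {a : Finset (C.Λ.Qubit q)}
    (ha : C.code.IsLogical (pauliString pauliX a)) : 1 ≤ C.size := by
  rw [size, Nat.one_le_iff_ne_zero, Ne, Fintype.card_eq_zero_iff]
  intro hempty
  refine ha.2.2 ?_
  rw [Finset.eq_empty_of_isEmpty a, pauliString_empty]
  exact Subalgebra.one_mem _

theorem card_stars_le (h : 1 ≤ C.size) : C.stars.card ≤ nS * C.size := by
  have hq : 1 ≤ q := by
    rw [Nat.one_le_iff_ne_zero]
    rintro rfl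
    simp [size] at h
  calc C.stars.card ≤ Fintype.card (C.Λ.cells × Fin nS) := Finset.card_le_univ _
    _ = nS * (Fintype.card C.Λ.cells * 1) := by
        rw [Fintype.card_prod, Fintype.card_fin, mul_one, mul_comm]
    _ ≤ nS * (Fintype.card C.Λ.cells * q) := by gcongr
    _ = nS * C.size := by rw [size, Fintype.card_prod, Fintype.card_fin]

theorem norm_trace_evolve_le {β α : ℝ} (hs : JumpRates β C.code.starField)
    (hp : JumpRates β C.code.plaqField) (hβ : 0 ≤ β)
    (hM : ∀ σ, IsFullRankState σ →
      2 * α * relEntropy σ (longTimeLimit (C.code.starLindbladian hs) σ)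
        ≤ entropyProduction (C.code.starLindbladian hs) σ)
    {σ O : Op (Config (C.Λ.Qubit q))} (hσ : IsState σ)
    (hO : C.code.IsLogicalX O ∨ C.code.IsLogicalY O) {t : ℝ} (ht : 0 ≤ t) :
    1 ≤ C.size ∧ ‖(evolve (C.code.daviesLindbladian hs hp) t σ * O).trace‖
      ≤ 4 * (1 + (2 * β * nS + 1) * C.size) * Real.exp (-α * t) := by
  -- One estimate covers both cases: `X_L` is `b = ∅`, and for `Y_L` the string `b` comes from
  -- `Z_L`, of which only commutation with the stars matters.
  have key : ∀ a b : Finset (C.Λ.Qubit q), C.code.IsLogicalX (pauliString pauliX a) →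
      (∀ s, Commute (pauliString pauliZ b) (C.code.starOp s)) →
      1 ≤ C.size ∧ ‖(evolve (C.code.daviesLindbladian hs hp) t σ
        * (pauliString pauliX a * pauliString pauliZ b)).trace‖
      ≤ 4 * (1 + (2 * β * nS + 1) * C.size) * Real.exp (-α * t) := by
    intro a b ha hb
    have h1 := C.one_le_size_of_isLogical ha.1
    refine ⟨h1, (C.code.norm_trace_evolve_le hs hp hβ hM ha hb hσ ht).trans ?_⟩
    refine mul_le_mul_of_nonneg_right ?_ (Real.exp_pos _).le
    refine mul_le_mul_of_nonneg_left ?_ (by norm_num)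
    have h2 : (C.stars.card : ℝ) ≤ nS * C.size := by exact_mod_cast C.card_stars_le h1
    have h3 : 2 * β * Fintype.card C.stars + Fintype.card (C.Λ.Qubit q) * Real.log 2
        ≤ (2 * β * nS + 1) * C.size := by
      rw [Fintype.card_coe]
      have h4 : Real.log 2 ≤ 1 := by linarith [Real.log_two_lt_d9]
      have h5 : (Fintype.card (C.Λ.Qubit q) : ℝ) = C.size := rfl
      have h6 := mul_le_mul_of_nonneg_left h2 (by positivity : 0 ≤ 2 * β)
      have h7 := mul_le_mul_of_nonneg_left h4 (Nat.cast_nonneg (α := ℝ) C.size)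
      rw [h5]
      linarith
    have h8 : 0 ≤ (2 * β * nS + 1) * (C.size : ℝ) := by positivity
    -- `√y ≤ 1 + y` trades the square root for a polynomial.
    refine (Real.sqrt_le_sqrt h3).trans (Real.sqrt_le_iff.2 ⟨by linarith, ?_⟩)
    nlinarith
  rcases hO with h | ⟨X, Z, hX, hZ, rfl⟩
  · obtain ⟨a, rfl⟩ := h.2
    have := key a ∅ h fun s => by
      rw [pauliString_empty]
      exact Commute.one_left _
    rwa [pauliString_empty, mul_one] at this
  · obtain ⟨a, rfl⟩ := hX.2
    obtain ⟨b, rfl⟩ := hZ.2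
    have := key a b hX hZ.1.1
    rwa [Matrix.mul_smul, Matrix.trace_smul, smul_eq_mul, norm_mul, Complex.norm_I, one_mul]

end LatticeCSSCode

end CSSDavies

/-! ### Polynomial prefactor and loss of information in logarithmic time -/

theorem mainTheorem3 (D q nS nP : ℕ) (β : ℝ) (hβ : 0 < β) :
    ∃ poly : Polynomial ℝ,
      ∀ (F : CSSDavies.CSSFamily D q nS nP)
        (hs : ∀ k, CSSDavies.JumpRates β (F.member k).code.starField)
        (hp : ∀ k, CSSDavies.JumpRates β (F.member k).code.plaqField)
        (α : ℝ), 0 < α →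
        CSSDavies.SatisfiesMLSI (fun k => (F.member k).code.starLindbladian (hs k)) α →
        -- polynomial prefactor, exponential decay at the rate `α`
        (∀ (k : ℕ) (σ O : CSSDavies.Op (CSSDavies.Config ((F.member k).Λ.Qubit q))) (t : ℝ),
          CSSDavies.IsState σ →
          (F.member k).code.IsLogicalX O ∨ (F.member k).code.IsLogicalY O →
          0 < t →
          ‖(CSSDavies.evolve ((F.member k).code.daviesLindbladian (hs k) (hp k)) t σ * O).trace‖
            ≤ poly.eval ((F.member k).size : ℝ) * Real.exp (-α * t)) ∧
        -- loss of the logical information in a time logarithmic in the system size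
        (∀ ε : ℝ, 0 < ε → ∃ c : ℝ, 0 < c ∧
          ∀ (k : ℕ) (σ O : CSSDavies.Op (CSSDavies.Config ((F.member k).Λ.Qubit q))) (t : ℝ),
            CSSDavies.IsState σ →
            (F.member k).code.IsLogicalX O ∨ (F.member k).code.IsLogicalY O →
            c * (1 + Real.log ((F.member k).size : ℝ)) ≤ t →
            ‖(CSSDavies.evolve ((F.member k).code.daviesLindbladian (hs k) (hp k)) t σ * O).trace‖
              ≤ ε) := by
  refine ⟨Polynomial.C 4 * (1 + Polynomial.C (2 * β * nS + 1) * Polynomial.X), ?_⟩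
  intro F hs hp α hα hM
  have key := fun (k : ℕ) (σ O : CSSDavies.Op (CSSDavies.Config ((F.member k).Λ.Qubit q))) (t : ℝ)
      (hσ : CSSDavies.IsState σ)
      (hO : (F.member k).code.IsLogicalX O ∨ (F.member k).code.IsLogicalY O) (ht : 0 ≤ t) =>
    (F.member k).norm_trace_evolve_le (hs k) (hp k) hβ.le (hM k) hσ hO ht
  refine ⟨fun k σ O t hσ hO ht => ?_, fun ε hε => ?_⟩
  · simpa using (key k σ O t hσ hO ht.le).2
  -- For size `N ≥ 1` the linear prefactor is at most `K * N`.
  set K : ℝ := 4 * (2 + 2 * β * nS) with hK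
  have hKpos : 0 < K := by positivity
  -- Chosen so that `α * c` is at least `log (K / ε)` and at least 1: the former absorbs the
  -- constants, the latter makes `α * c * log N` dominate `log N`.
  refine ⟨(1 + |Real.log (K / ε)|) / α, by positivity, fun k σ O t hσ hO ht => ?_⟩
  set c := (1 + |Real.log (K / ε)|) / α with hc
  have hcpos : 0 < c := by positivity
  by_cases ht0 : 0 ≤ t
  · obtain ⟨hN, h⟩ := key k σ O t hσ hO ht0
    refine h.trans ?_
    have hN' : (1 : ℝ) ≤ (F.member k).size := by exact_mod_cast hN
    set N : ℝ := ((F.member k).size : ℝ)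
    have hαc : α * c = 1 + |Real.log (K / ε)| := by
      rw [hc]
      field_simp
    have hlogN : 0 ≤ Real.log N := Real.log_nonneg hN'
    have h1 : Real.log (K / ε) + Real.log N ≤ α * t := by
      have h2 := mul_le_mul_of_nonneg_left ht hα.le
      have h3 : 1 * Real.log N ≤ α * c * Real.log N :=
        mul_le_mul_of_nonneg_right (by rw [hαc]; linarith [abs_nonneg (Real.log (K / ε))]) hlogN
      have h4 := le_abs_self (Real.log (K / ε))
      nlinarith
    have h5 : Real.exp (-α * t) ≤ (K / ε * N)⁻¹ := by
      rw [← Real.exp_log (by positivity : 0 < (K / ε * N)⁻¹), Real.log_inv,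
        Real.log_mul (by positivity) (by positivity)]
      exact Real.exp_le_exp.2 (by linarith)
    calc 4 * (1 + (2 * β * nS + 1) * N) * Real.exp (-α * t)
        ≤ K * N * (K / ε * N)⁻¹ := by
          refine mul_le_mul ?_ h5 (Real.exp_pos _).le (by positivity)
          rw [hK]
          linarith
      _ = ε := by field_simp
  -- The logarithm of a natural number is nonnegative, with `log 0 = 0`, so the time threshold
  -- already forces `0 ≤ t`.
  · have hN : 0 ≤ Real.log ((F.member k).size : ℝ) := Real.log_natCast_nonneg _
    exact absurd (le_trans (by positivity) ht) ht0
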